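/- **Setting.** Let $T>0$, and let $B$ be a $q$-dimensional Brownian motion on a filtered probability space. Let $X$ be a continuous adapted solution on $[0,T]$ of $dX_t=b(X_t)\,dt+\sum_{j=1}^q\sigma_j(X_t)\,dB^j_t$, $X_0=x\in\mathbb R^d$, where $b,\sigma_j:\mathbb R^d\to\mathbb R^d$ satisfy $|b(y)-b(z)|+\sum_j|\sigma_j(y)-\sigma_j(z)|\le K|y-z|$ for some $K>0$. Let $P:\mathbb R^d\to\mathbb R$ be measurable, with $\operatorname{Var}(P(X_T))>0$, and put $\mathbf J_0=\mathbb E[P(X_T)]$. **Discretization.** Let $M\ge 2$ and $m\ge1$ be integers, $\mathbf h=T/m$, $n_l=M^{l-1}$ for $l\ge1$, and $\mathcal H=\{\mathbf h/n:\ n\ge1\}$. Fix a one-step scheme given by measurable maps $\Psi_h:\mathbb R^d\times\mathbb R^q\to\mathbb R^d$ (for example the Euler scheme $\Psi_h(y,w)=y+hb(y)+\sum_j w_j\sigma_j(y)$, or, for $d=q=1$, the Milstein scheme). For a path $w$, $\theta\in\mathbb R^q$ and $h\in\mathcal H$ put $X^h_{0,\theta}(w)=x$ and $X^h_{(i+1)h,\theta}(w)=\Psi_h\big(X^h_{ih,\theta}(w),\,w_{(i+1)h}-w_{ih}+h\theta\big)$;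 write $X^{h}_T=X^h_{T,0}(B)$ and $X^{n_l}_{T,\theta}(w)=X^{\mathbf h/n_l}_{T,\theta}(w)$. Let $\mathcal J^-(w,\theta)=\exp(-\langle\theta,w\rangle-\tfrac12|\theta|^2T)$. **Weights and parameters.** Let $\alpha,\beta>0$. For $L\ge1$ let $(w_l)_{1\le l\le L}$ solve $\sum_{l=1}^L n_l^{-\alpha(i-1)}w_l=\mathbf 1_{\{i=1\}}$, $1\le i\le L$, and let $\widetilde W_l=\widetilde W_l^{(L)}=\sum_{j=l}^L w_j$. Let $V_1,\widetilde c,A>0$ be constants, and $\lambda=\sqrt{V_1/\operatorname{Var}(P(X_T))}$, $\underline C=\frac{1+M^{\beta/2}}{\sqrt{1+M^{-1}}}$, $\overline C=(1+M^{\beta/2})\sqrt{1+M^{-1}}$. For $\epsilon>0$ set $\kappa=\frac12+\frac{\log(\widetilde c^{1/\alpha}\mathbf h)}{\log M}$ and $$L(\epsilon)=\Big\lceil \kappa+\sqrt{\kappa^2+\tfrac{2\log(A/\epsilon)}{\alpha\log M}}\ \Big\rceil,$$ and, with $L=L(\epsilon)$, $$\mu_1=q^*(1+\lambda\mathbf h^{\beta/2}),\qquad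 \mu_l=q^*\lambda\mathbf h^{\beta/2}\,\underline C\,|\widetilde W_l|\,M^{-\frac{1+\beta}2(l-1)}\ (2\le l\le L),$$ where $q^*$ is such that $\sum_{l=1}^L\mu_l=1$, $$N(\epsilon)=\Big(1+\frac1{2\alpha L}\Big)\frac{\operatorname{Var}(P(X_T))\Big(1+\lambda\mathbf h^{\beta/2}+\lambda\mathbf h^{\beta/2}\,\overline C\sum_{l=2}^L|\widetilde W_l|M^{\frac{1-\beta}2(l-1)}\Big)}{\epsilon^2q^*},\qquad N_l=N_l(\epsilon)=\lceil N(\epsilon)\mu_l\rceil .$$ (For small $\epsilon$ these are well defined with $L(\epsilon)\ge 1$; only small $\epsilon$ matters.) **Estimator.** Let $(W^{l,k})_{l,k\ge1}$ be $q$-dimensional Brownian motions that are independent on $[0,T]$, let $\Theta\subset\mathbb R^q$ be compact, and for $l\ge1$, $k\ge0$ let $\theta_l^k$ be a $\Theta$-valued random variable that is measurable with respect to $\sigma(W^{l',j}_t:\ l'\ge1,\ 1\le j\le k,\ t\le T)$. The adaptive importance sampling ML2R estimator is $$\mathbf J^{N,\theta}_\pi(\epsilon)=\frac1{N_1}\sum_{k=1}^{N_1}P\big(X^{n_1}_{T,\theta_1^{k-1}}(W^{1,k})\big)\mathcal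 J^-(W^{1,k}_T,\theta_1^{k-1})+\sum_{l=2}^{L(\epsilon)}\frac{\widetilde W_l}{N_l}\sum_{k=1}^{N_l}\Big(P\big(X^{n_l}_{T,\theta_l^{k-1}}(W^{l,k})\big)-P\big(X^{n_{l-1}}_{T,\theta_l^{k-1}}(W^{l,k})\big)\Big)\mathcal J^-(W^{l,k}_T,\theta_l^{k-1}).$$ **Theorem.** Suppose that for every $l\ge 1$ there is $\theta_l^*\in\Theta$ with $\theta_l^k\to\theta_l^*$ almost surely as $k\to\infty$. Let $p\ge2$ and assume: 1. (weak error of every order) there are reals $(c_k)_{k\ge1}$ such that for every $R\ge1$ there is a function $\eta_R$ with $\eta_R(h)\to0$ as $h\to0^+$ and $\mathbb E[P(X_T^h)]-\mathbb E[P(X_T)]=\sum_{k=1}^{R}c_kh^{\alpha k}+h^{\alpha R}\eta_R(h)$ for all $h\in\mathcal H$; 2. $P(X_T)\in L^p$; 3. ($L^p$ strong error) there is $V_1^{(p)}>0$ with $\mathbb E\big[|P(X_T^h)-P(X_T)|^p\big]\le V_1^{(p)}h^{\beta p/2}$ for all $h\in\mathcal H$. Then for every sequence $(\epsilon_k)_{k\ge1}$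 of positive reals with $\sum_k\epsilon_k^p<\infty$, $\ \mathbf J^{N,\theta}_\pi(\epsilon_k)\to\mathbf J_0$ almost surely as $k\to\infty$. -/

import Mathlib

open MeasureTheory ProbabilityTheory Filter Topology
open scoped NNReal ENNReal

noncomputable section

namespace AISML2R

/-- `ℝⁿ` with its Euclidean norm. -/
abbrev E (n : ℕ) : Type := EuclideanSpace ℝ (Fin n)

/-! ### Brownian motion and the stochastic differential equation -/

section Brownian

variable {Ω : Type*} [mΩ : MeasurableSpace Ω] {d q : ℕ}

/-- Standard `q`-dimensional Brownian motion: the coordinates are independent real Brownian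
motions. -/
structure IsBrownianMotion (W : ℝ≥0 → Ω → E q) (μ : Measure Ω) : Prop where
  measurable : ∀ t, Measurable (W t)
  coord : ∀ j : Fin q, IsBrownianReal (fun t ω => W t ω j) μ
  indep : iIndepFun (fun (j : Fin q) (ω : Ω) (t : ℝ≥0) => W t ω j) μ

/-- Standard `q`-dimensional Brownian motion with respect to the filtration `𝓕`. -/
structure IsFBrownianMotion (𝓕 : Filtration ℝ≥0 mΩ) (W : ℝ≥0 → Ω → E q) (μ : Measure Ω) : Prop
    extends IsBrownianMotion W μ where
  adapted : Adapted 𝓕 W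
  indep_past : ∀ s t : ℝ≥0, s ≤ t →
    Indep (MeasurableSpace.comap (fun ω => W t ω - W s ω) inferInstance) (𝓕 s) μ

/-- The left-point Riemann sum of `∑ⱼ ∫₀ᵗ σⱼ(X_s) dBʲ_s` for the partition of `[0, t]` into `n`
intervals of equal length. -/
def itoSum (σ : Fin q → E d → E d) (B : ℝ≥0 → Ω → E q) (X : ℝ≥0 → Ω → E d)
    (t : ℝ≥0) (n : ℕ) (ω : Ω) : E d :=
  ∑ i ∈ Finset.range n, ∑ j : Fin q,
    (B ((i + 1) * (t / n)) ω j - B (i * (t / n)) ω j) • σ j (X (i * (t / n)) ω)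

/-- `X` is a continuous adapted solution on `[0, T]` of
`dX = b(X) dt + ∑ⱼ σⱼ(X) dBʲ`, `X₀ = x`.  For a continuous adapted integrand (and continuous
coefficients) the Itô integral is the limit in probability of its left-point Riemann sums along
partitions of vanishing mesh; this is how the stochastic integral is expressed here. -/
structure IsSDESolution (T : ℝ≥0) (b : E d → E d) (σ : Fin q → E d → E d) (x : E d)
    (𝓕 : Filtration ℝ≥0 mΩ) (B : ℝ≥0 → Ω → E q) (X : ℝ≥0 → Ω → E d) (μ : Measure Ω) :
    Prop where
  adapted : ∀ t ≤ T, Measurable[𝓕 t] (X t)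
  continuous : ∀ᵐ ω ∂μ, ContinuousOn (fun t => X t ω) (Set.Icc 0 T)
  initial : ∀ᵐ ω ∂μ, X 0 ω = x
  equation : ∀ t ≤ T, TendstoInMeasure μ (itoSum σ B X t) atTop
    (fun ω => X t ω - x - ∫ s in (0 : ℝ)..(t : ℝ), b (X s.toNNReal ω))

/-- The σ-algebra generated by a path up to time `T`. -/
@[reducible] def pathSigma (T : ℝ≥0) (W : ℝ≥0 → Ω → E q) : MeasurableSpace Ω :=
  ⨆ t : ℝ≥0, ⨆ _ : t ≤ T, MeasurableSpace.comap (W t) inferInstance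

/-- The σ-algebra generated, on all levels, by the first `k` sample paths (those with
numbers `0, …, k - 1`) up to time `T`. -/
@[reducible] def pastSigma (T : ℝ≥0) (W : ℕ → ℕ → ℝ≥0 → Ω → E q) (k : ℕ) : MeasurableSpace Ω :=
  ⨆ l : ℕ, ⨆ j : ℕ, ⨆ _ : j < k, pathSigma T (W l j)

end Brownian

/-! ### Discretization and importance sampling -/

section Scheme

variable {d q : ℕ}

/-- A one-step discretization scheme with one-step map `Ψ h y w` (`h` step size, `y` present state,
`w` increment of the driving path), run with step `h` along the drifted path `t ↦ w t + t θ`.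
For instance `Ψ h y w = y + h b(y) + ∑ⱼ wⱼ σⱼ(y)` is the Euler scheme, which along the
drifted path is the Euler scheme of `dX = (b(X) + σ(X) θ) dt + σ(X) dW`, and in dimension one
`Ψ h y w = y + h b(y) + w σ(y) + σ'(y) σ(y) (w² - h) / 2` is the Milstein scheme. -/
def schemePath (Ψ : ℝ → E d → E q → E d) (h : ℝ≥0) (x : E d) (w : ℝ≥0 → E q) (θ : E q) :
    ℕ → E d
  | 0 => x
  | i + 1 => Ψ h (schemePath Ψ h x w θ i) (w ((i + 1) * h) - w (i * h) + (h : ℝ) • θ)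

/-- The value at time `T` of the scheme with `n` steps of size `T / n`. -/
def schemeEnd (Ψ : ℝ → E d → E q → E d) (T : ℝ≥0) (x : E d) (n : ℕ) (w : ℝ≥0 → E q)
    (θ : E q) : E d :=
  schemePath Ψ (T / n) x w θ n

/-- The Girsanov density `exp (-⟨θ, w⟩ - |θ|² T / 2)`. -/
def girsanov (T : ℝ≥0) (w θ : E q) : ℝ :=
  Real.exp (-inner ℝ θ w - ‖θ‖ ^ 2 * T / 2)

end Scheme

/-! ### Multilevel Richardson–Romberg weights

Levels are numbered from `0`: level `l` here is the level `l + 1` of a numbering from `1`, and has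
refinement `M ^ l`. -/

/-- The Vandermonde matrix with entries `n_j ^ (-α i)`, `n_j = M ^ j`. -/
def vandermondeMatrix (α : ℝ) (M L : ℕ) : Matrix (Fin L) (Fin L) ℝ :=
  Matrix.of fun i j => ((M : ℝ) ^ (j : ℕ)) ^ (-(α * (i : ℕ)))

/-- The solution `w` of the system `V w = e₁`. -/
def weight (α : ℝ) (M L : ℕ) : Fin L → ℝ :=
  Matrix.mulVec (vandermondeMatrix α M L)⁻¹ (fun i => if (i : ℕ) = 0 then 1 else 0)

/-- The cumulated weight `∑_{j ≥ l} w_j`. -/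
def cumWeight (α : ℝ) (M L l : ℕ) : ℝ :=
  ∑ j : Fin L, if l ≤ (j : ℕ) then weight α M L j else 0

/-! ### Parameters of the estimator -/

/-- The structural constants: horizon `T`, refinement factor `M`, number `m` of time steps on the
coarsest level, weak and strong error rates `α`, `β`, and the constants `V₁`, `varP`
(the variance of the payoff), `c` and `A` that enter the choice of the sample sizes and of the
number of levels. -/
structure Params where
  T : ℝ≥0
  M : ℕ
  m : ℕ
  α : ℝ
  β : ℝ
  V₁ : ℝ
  varP : ℝ
  c : ℝ
  A : ℝ

namespace Params

variable (r : Params)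

/-- The coarsest time step. -/
def hbar : ℝ := r.T / r.m

def lam : ℝ := Real.sqrt (r.V₁ / r.varP)

def lowC : ℝ := (1 + (r.M : ℝ) ^ (r.β / 2)) / Real.sqrt (1 + (r.M : ℝ)⁻¹)

def upC : ℝ := (1 + (r.M : ℝ) ^ (r.β / 2)) * Real.sqrt (1 + (r.M : ℝ)⁻¹)

/-- The number of levels `L(ε)`. -/
def numLevels (ε : ℝ) : ℕ :=
  ⌈1 / 2 + Real.log (r.c ^ (1 / r.α) * r.hbar) / Real.log r.M
    + Real.sqrt ((1 / 2 + Real.log (r.c ^ (1 / r.α) * r.hbar) / Real.log r.M) ^ 2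
      + 2 * Real.log (r.A / ε) / (r.α * Real.log r.M))⌉₊

/-- The allocation `μ_l / q*` before normalization. -/
def alloc (L l : ℕ) : ℝ :=
  if l = 0 then 1 + r.lam * r.hbar ^ (r.β / 2)
  else r.lam * r.hbar ^ (r.β / 2) * r.lowC * |cumWeight r.α r.M L l|
    * (r.M : ℝ) ^ (-((1 + r.β) / 2) * l)

/-- The normalizing constant `q*`, which makes the `μ_l` sum to one. -/
def qstar (L : ℕ) : ℝ := (∑ l ∈ Finset.range L, r.alloc L l)⁻¹

def mu (L l : ℕ) : ℝ := r.qstar L * r.alloc L l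

/-- The total sample size `N(ε)`. -/
def totalN (ε : ℝ) : ℝ :=
  (1 + 1 / (2 * r.α * r.numLevels ε)) *
    (r.varP * (1 + r.lam * r.hbar ^ (r.β / 2)
      + r.lam * r.hbar ^ (r.β / 2) * r.upC *
        ∑ l ∈ Finset.Ico 1 (r.numLevels ε),
          |cumWeight r.α r.M (r.numLevels ε) l| * (r.M : ℝ) ^ ((1 - r.β) / 2 * l)))
    / (ε ^ 2 * r.qstar (r.numLevels ε))

/-- The sample size `N_l(ε) = ⌈N(ε) μ_l(ε)⌉` of level `l`. -/
def levelN (ε : ℝ) (l : ℕ) : ℕ := ⌈r.totalN ε * r.mu (r.numLevels ε) l⌉₊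

/-- The number of time steps on level `l`. -/
def steps (l : ℕ) : ℕ := r.m * r.M ^ l

end Params

/-! ### The estimator -/

section Estimator

variable {Ω : Type*} {d q : ℕ}

/-- The weighted payoff on level `l` along the driving path `w` with parameter `θ`: the payoff of
the scheme on level `0`, and the difference of the payoffs of the schemes on the levels `l` and
`l - 1` (both driven by `w`) for `l ≥ 1`, times the Girsanov density. -/
def levelTerm (r : Params) (Ψ : ℝ → E d → E q → E d) (x : E d) (P : E d → ℝ)
    (l : ℕ) (w : ℝ≥0 → E q) (θ : E q) : ℝ :=
  (if l = 0 then P (schemeEnd Ψ r.T x (r.steps 0) w θ)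
    else P (schemeEnd Ψ r.T x (r.steps l) w θ) - P (schemeEnd Ψ r.T x (r.steps (l - 1)) w θ))
    * girsanov r.T (w r.T) θ

/-- The adaptive importance sampling ML2R estimator with accuracy parameter `ε`.  The path number
`k` (numbered from `0`) on level `l` is `W l k` and is simulated with the parameter `θ l k`. -/
def estimator (r : Params) (Ψ : ℝ → E d → E q → E d) (x : E d) (P : E d → ℝ)
    (W : ℕ → ℕ → ℝ≥0 → Ω → E q) (θ : ℕ → ℕ → Ω → E q) (ε : ℝ) (ω : Ω) : ℝ :=
  (1 / (r.levelN ε 0 : ℝ)) *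
      ∑ k ∈ Finset.range (r.levelN ε 0),
        levelTerm r Ψ x P 0 (fun t => W 0 k t ω) (θ 0 k ω)
    + ∑ l ∈ Finset.Ico 1 (r.numLevels ε),
      cumWeight r.α r.M (r.numLevels ε) l / (r.levelN ε l : ℝ) *
        ∑ k ∈ Finset.range (r.levelN ε l),
          levelTerm r Ψ x P l (fun t => W l k t ω) (θ l k ω)

end Estimator

/-! ### Error assumptions -/

section Errors

variable {Ω : Type*} [MeasurableSpace Ω] {d q : ℕ}

/-- The payoff of the scheme with `n` steps per coarsest time step, i.e. with step size
`hbar / n`, driven by the reference Brownian motion `B` (without drift parameter). -/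
def approxPayoff (r : Params) (Ψ : ℝ → E d → E q → E d) (x : E d) (P : E d → ℝ)
    (B : ℝ≥0 → Ω → E q) (n : ℕ) (ω : Ω) : ℝ :=
  P (schemeEnd Ψ r.T x (r.m * n) (fun t => B t ω) 0)

/-- Weak error expansion of every order, with rate `α`, for the step sizes
`h = hbar / n`, `n ≥ 1`. -/
def WeakError (r : Params) (Ψ : ℝ → E d → E q → E d) (x : E d) (P : E d → ℝ)
    (B : ℝ≥0 → Ω → E q) (X : ℝ≥0 → Ω → E d) (μ : Measure Ω) : Prop :=
  ∃ c : ℕ → ℝ, ∀ R : ℕ, 1 ≤ R → ∃ η : ℝ → ℝ, Tendsto η (𝓝[>] 0) (𝓝 0) ∧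
    ∀ n : ℕ, 1 ≤ n →
      ∫ ω, approxPayoff r Ψ x P B n ω ∂μ - ∫ ω, P (X r.T ω) ∂μ =
        ∑ k ∈ Finset.Icc 1 R, c k * (r.hbar / n) ^ (r.α * k)
          + (r.hbar / n) ^ (r.α * R) * η (r.hbar / n)

/-- `L^p` strong error of rate `β` with constant `V`, for the step sizes
`h = hbar / n`, `n ≥ 1`. -/
def StrongError (r : Params) (Ψ : ℝ → E d → E q → E d) (x : E d) (P : E d → ℝ)
    (B : ℝ≥0 → Ω → E q) (X : ℝ≥0 → Ω → E d) (μ : Measure Ω) (p V : ℝ) : Prop :=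
  ∀ n : ℕ, 1 ≤ n →
    ∫⁻ ω, ‖approxPayoff r Ψ x P B n ω - P (X r.T ω)‖ₑ ^ p ∂μ
      ≤ ENNReal.ofReal (V * (r.hbar / n) ^ (r.β * p / 2))

end Errors

end AISML2R

end

/-!
As a function of the increments of the driving path on a grid, a term of the estimator is a payoff
of the shifted increments times the Girsanov density of the shift. By Cameron–Martin its
conditional expectation given the earlier sample paths is therefore the expectation without the
shift, the same for all terms of a level, and the centred terms of a level are martingale
differences. The Girsanov densities have moments of all orders, locally uniformly in the parameter,
so that the level terms are bounded in `L ^ s` for every `1 ≤ s < p`. For `1 < s < 2`, the von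
Bahr–Esseen inequality, Doob's maximal inequality and Kronecker's argument bound the sum of the
first `n` centred terms of level `l` almost surely by `K * 2 ^ l * n ^ γ`, uniformly in `l` and `n`,
with some `γ < 1`.

The sample sizes are at least a multiple of `ε⁻² |W̃_l| exp (-κ l)`, while the number `L` of levels
grows only like the square root of `log (1 / ε)`: the centred terms contribute at most a positive
power of `ε` times `exp (O(L))`, which tends to `0`. The means contribute
`∑ l, W̃_l (a_l - a_{l-1})`, where `a_l` is the mean of the payoff of the scheme with `M ^ l` steps
per time step of length `T / m`. By summation by parts this is a Richardson–Romberg extrapolation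
of the `a_l`: its weights add up to `1` and concentrate geometrically on the last levels, so that
it tends to the limit of `a_l`.
-/

noncomputable section

namespace AISML2R

/-! ### Richardson–Romberg weights -/

section Weights

/-- The extrapolation weights for the nodes `ρ ^ 0, …, ρ ^ (L - 1)`: the values at `0` of the
Lagrange basis, so that `∑ l, w_l p(ρ ^ l) = p 0` for polynomials `p` of degree less than `L`. -/
def richardsonWeight (ρ : ℝ) (L l : ℕ) : ℝ :=
  (Lagrange.basis (Finset.range L) (fun j => ρ ^ j) l).eval 0

/-- The differences of consecutive terms of a sequence, starting with the term number `0` itself: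
the contributions of the levels to a multilevel decomposition. -/
def levelDiff (a : ℕ → ℝ) : ℕ → ℝ
  | 0 => a 0
  | l + 1 => a (l + 1) - a l

lemma sum_range_succ_levelDiff (a : ℕ → ℝ) (n : ℕ) :
    ∑ l ∈ Finset.range (n + 1), levelDiff a l = a n := by
  rw [Finset.sum_range_succ', levelDiff]
  simp only [levelDiff, Finset.sum_range_sub]
  ring

lemma sum_tail_mul_levelDiff (w a : ℕ → ℝ) (L : ℕ) :
    ∑ l ∈ Finset.range L, (∑ j ∈ Finset.Ico l L, w j) * levelDiff a l =
      ∑ j ∈ Finset.range L, w j * a j := by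
  simp only [Finset.sum_mul, ← sum_range_succ_levelDiff a, Finset.mul_sum]
  exact Finset.sum_comm' fun l j => by simp only [Finset.mem_range, Finset.mem_Ico]; omega

variable {ρ : ℝ}

lemma sum_richardsonWeight_mul_pow (h0 : 0 < ρ) (h1 : ρ < 1) {L i : ℕ} (hi : i < L) :
    ∑ l ∈ Finset.range L, (ρ ^ l) ^ i * richardsonWeight ρ L l = if i = 0 then 1 else 0 := by
  have h := Lagrange.eq_interpolate (s := Finset.range L) (v := fun j => ρ ^ j)
    (f := (Polynomial.X : Polynomial ℝ) ^ i) (pow_right_injective₀ h0 h1.ne).injOn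
    (by rw [Polynomial.degree_X_pow, Finset.card_range]; exact_mod_cast hi)
  have h2 := congrArg (Polynomial.eval 0) h
  simp only [Lagrange.interpolate_apply, Polynomial.eval_finsetSum, Polynomial.eval_mul,
    Polynomial.eval_C, Polynomial.eval_pow, Polynomial.eval_X, zero_pow_eq] at h2
  exact h2.symm

lemma sum_richardsonWeight (h0 : 0 < ρ) (h1 : ρ < 1) {L : ℕ} (hL : 0 < L) :
    ∑ l ∈ Finset.range L, richardsonWeight ρ L l = 1 := by
  simpa using sum_richardsonWeight_mul_pow h0 h1 hL

lemma geom_sum_le_inv_one_sub (h0 : 0 ≤ ρ) (h1 : ρ < 1) (n : ℕ) :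
    ∑ i ∈ Finset.range n, ρ ^ i ≤ (1 - ρ)⁻¹ := by
  rw [← tsum_geometric_of_lt_one h0 h1]
  exact (summable_geometric_of_lt_one h0 h1).sum_le_tsum _ fun i _ => by positivity

lemma inv_one_sub_le_exp {u : ℝ} (hu : u < 1) : (1 - u)⁻¹ ≤ Real.exp (u / (1 - u)) := by
  have h : (1 - u)⁻¹ = u / (1 - u) + 1 := by
    have : 1 - u ≠ 0 := by linarith
    field_simp
    ring
  exact h.trans_le (Real.add_one_le_exp _)

lemma prod_inv_one_sub_pow_le (h0 : 0 ≤ ρ) (h1 : ρ < 1) (n : ℕ) :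
    ∏ k ∈ Finset.range n, (1 - ρ ^ (k + 1))⁻¹ ≤ Real.exp ((1 - ρ)⁻¹ * (1 - ρ)⁻¹) := by
  have : 0 < 1 - ρ := by linarith
  have hpow (k : ℕ) : ρ ^ (k + 1) ≤ ρ := pow_le_of_le_one h0 h1.le k.succ_ne_zero
  calc ∏ k ∈ Finset.range n, (1 - ρ ^ (k + 1))⁻¹
      ≤ ∏ k ∈ Finset.range n, Real.exp (ρ ^ k * (1 - ρ)⁻¹) := by
        refine Finset.prod_le_prod (fun k _ => inv_nonneg.2 (by linarith [hpow k])) fun k _ => ?_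
        refine (inv_one_sub_le_exp (by linarith [hpow k])).trans (Real.exp_le_exp.2 ?_)
        rw [div_eq_mul_inv]
        gcongr ?_ * (1 - ?_)⁻¹
        · exact inv_nonneg.2 (by linarith [hpow k])
        · exact pow_le_pow_of_le_one h0 h1.le k.le_succ
        · exact hpow k
    _ = Real.exp ((∑ k ∈ Finset.range n, ρ ^ k) * (1 - ρ)⁻¹) := by
        rw [← Real.exp_sum, Finset.sum_mul]
    _ ≤ _ := by
        gcongr
        exact geom_sum_le_inv_one_sub h0 h1 n

lemma abs_richardsonWeight (h0 : 0 < ρ) (h1 : ρ < 1) (l n : ℕ) :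
    |richardsonWeight ρ (l + 1 + n) l| = (∏ k ∈ Finset.range l, (1 - ρ ^ (k + 1))⁻¹) *
      ∏ k ∈ Finset.range n, ρ ^ (k + 1) * (1 - ρ ^ (k + 1))⁻¹ := by
  have hfactor (k : ℕ) : 0 < 1 - ρ ^ (k + 1) := sub_pos.2 (pow_lt_one₀ h0.le h1 k.succ_ne_zero)
  have hprod : richardsonWeight ρ (l + 1 + n) l = ∏ j ∈ Finset.range (l + 1 + n),
      if j = l then 1 else (ρ ^ l - ρ ^ j)⁻¹ * (0 - ρ ^ j) := by
    rw [Finset.prod_ite, Finset.prod_const_one, one_mul, Finset.filter_ne']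
    simp [richardsonWeight, Lagrange.basis, Lagrange.basisDivisor, Polynomial.eval_prod]
  rw [hprod, Finset.prod_range_add, Finset.prod_range_succ, if_pos rfl, mul_one, abs_mul,
    Finset.abs_prod, Finset.abs_prod, ← Finset.prod_range_reflect _ l]
  congr 1 <;> refine Finset.prod_congr rfl fun k hk => ?_
  · obtain ⟨i, rfl⟩ := Nat.exists_eq_add_of_lt (Finset.mem_range.1 hk)
    have hi := hfactor k
    rw [show k + i + 1 - 1 - k = i by omega, if_neg (by omega), show ρ ^ (k + i + 1) - ρ ^ i =
      -(ρ ^ i * (1 - ρ ^ (k + 1))) by ring, zero_sub, ← abs_of_pos (inv_pos.2 hi)]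
    congr 1
    field_simp
  · have hk := hfactor k
    rw [if_neg (by omega), show ρ ^ l - ρ ^ (l + 1 + k) = ρ ^ l * (1 - ρ ^ (k + 1)) by ring,
      ← abs_of_pos (mul_pos (pow_pos h0 (k + 1)) (inv_pos.2 hk)), ← abs_neg]
    congr 1
    field_simp
    ring

lemma exists_abs_richardsonWeight_le (h0 : 0 < ρ) (h1 : ρ < 1) :
    ∃ C : ℝ, 0 < C ∧ ∀ L l : ℕ, l < L → |richardsonWeight ρ L l| ≤ C * ρ ^ (L - 1 - l) := by
  set Q : ℝ := Real.exp ((1 - ρ)⁻¹ * (1 - ρ)⁻¹)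
  refine ⟨Q * Q, by positivity, fun L l hl => ?_⟩
  obtain ⟨n, rfl⟩ := Nat.exists_eq_add_of_le (Nat.succ_le_of_lt hl)
  have hfactor (k : ℕ) : 0 ≤ (1 - ρ ^ (k + 1))⁻¹ :=
    inv_nonneg.2 (sub_nonneg.2 (pow_le_one₀ h0.le h1.le))
  have hQ := prod_inv_one_sub_pow_le h0.le h1
  have hpow : ∏ k ∈ Finset.range n, ρ ^ (k + 1) ≤ ρ ^ n := by
    calc ∏ k ∈ Finset.range n, ρ ^ (k + 1) ≤ ∏ _k ∈ Finset.range n, ρ :=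
          Finset.prod_le_prod (fun k _ => by positivity) fun k _ =>
            pow_le_of_le_one h0.le h1.le k.succ_ne_zero
      _ = ρ ^ n := by rw [Finset.prod_const, Finset.card_range]
  rw [Nat.succ_eq_add_one, abs_richardsonWeight h0 h1, Finset.prod_mul_distrib,
    show l + 1 + n - 1 - l = n by omega, mul_assoc, mul_comm Q (ρ ^ n)]
  have hprod (m : ℕ) : 0 ≤ ∏ k ∈ Finset.range m, (1 - ρ ^ (k + 1))⁻¹ :=
    Finset.prod_nonneg fun k _ => hfactor k
  exact mul_le_mul (hQ l) (mul_le_mul hpow (hQ n) (hprod n) (by positivity))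
    (mul_nonneg (Finset.prod_nonneg fun k _ => by positivity) (hprod n)) (by positivity)

lemma exists_abs_sum_richardsonWeight_le (h0 : 0 < ρ) (h1 : ρ < 1) :
    ∃ C : ℝ, ∀ L l : ℕ, |∑ j ∈ Finset.Ico l L, richardsonWeight ρ L j| ≤ C := by
  obtain ⟨C, hC, hw⟩ := exists_abs_richardsonWeight_le h0 h1
  refine ⟨C * (1 - ρ)⁻¹, fun L l => ?_⟩
  calc |∑ j ∈ Finset.Ico l L, richardsonWeight ρ L j|
      ≤ ∑ j ∈ Finset.Ico l L, |richardsonWeight ρ L j| := Finset.abs_sum_le_sum_abs _ _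
    _ ≤ ∑ j ∈ Finset.range L, |richardsonWeight ρ L j| :=
        Finset.sum_le_sum_of_subset_of_nonneg
          (fun j hj => Finset.mem_range.2 (Finset.mem_Ico.1 hj).2) fun _ _ _ => abs_nonneg _
    _ ≤ ∑ j ∈ Finset.range L, C * ρ ^ (L - 1 - j) :=
        Finset.sum_le_sum fun j hj => hw L j (Finset.mem_range.1 hj)
    _ = C * ∑ j ∈ Finset.range L, ρ ^ j := by
        rw [← Finset.mul_sum, Finset.sum_range_reflect (fun j => ρ ^ j)]
    _ ≤ C * (1 - ρ)⁻¹ := by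
        gcongr
        exact geom_sum_le_inv_one_sub h0.le h1 L

lemma tendsto_sum_geom_mul (h0 : 0 ≤ ρ) (h1 : ρ < 1) {u : ℕ → ℝ}
    (hu : Tendsto u atTop (𝓝 0)) :
    Tendsto (fun L : ℕ => ∑ i ∈ Finset.range L, ρ ^ i * u (L - 1 - i)) atTop (𝓝 0) := by
  obtain ⟨K, hK⟩ := (Metric.isBounded_range_of_tendsto u hu).exists_norm_le
  replace hK (n : ℕ) : ‖u n‖ ≤ K := hK _ ⟨n, rfl⟩
  have key := tendsto_tsum_of_dominated_convergence (𝓕 := atTop)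
    (f := fun (L : ℕ) (i : ℕ) => if i < L then ρ ^ i * u (L - 1 - i) else 0)
    (g := fun _ => (0 : ℝ)) (bound := fun i => ρ ^ i * K)
    ((summable_geometric_of_lt_one h0 h1).mul_right K) (fun i => ?_) (.of_forall fun L i => ?_)
  · rw [tsum_zero] at key
    refine key.congr fun L => ?_
    rw [tsum_eq_sum (s := Finset.range L) fun i hi => if_neg (by simpa using hi)]
    exact Finset.sum_congr rfl fun i hi => if_pos (Finset.mem_range.1 hi)
  · have hshift : Tendsto (fun L : ℕ => L - 1 - i) atTop atTop :=
      (tendsto_sub_atTop_nat i).comp (tendsto_sub_atTop_nat 1)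
    have hterm : Tendsto (fun L : ℕ => ρ ^ i * u (L - 1 - i)) atTop (𝓝 0) := by
      simpa using (hu.comp hshift).const_mul (ρ ^ i)
    refine hterm.congr' ?_
    filter_upwards [eventually_gt_atTop i] with L hL
    rw [if_pos hL]
  · have := (norm_nonneg _).trans (hK 0)
    split_ifs
    · rw [norm_mul, Real.norm_of_nonneg (pow_nonneg h0 i)]
      gcongr
      exact hK _
    · rw [norm_zero]
      positivity

lemma tendsto_sum_richardsonWeight_mul (h0 : 0 < ρ) (h1 : ρ < 1) {a : ℕ → ℝ} {J : ℝ}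
    (ha : Tendsto a atTop (𝓝 J)) :
    Tendsto (fun L : ℕ => ∑ j ∈ Finset.range L, richardsonWeight ρ L j * a j) atTop (𝓝 J) := by
  obtain ⟨C, -, hw⟩ := exists_abs_richardsonWeight_le h0 h1
  rw [tendsto_iff_norm_sub_tendsto_zero] at ha ⊢
  have hlim := (tendsto_sum_geom_mul h0.le h1 ha).const_mul C
  rw [mul_zero] at hlim
  refine squeeze_zero' (.of_forall fun _ => norm_nonneg _) ?_ hlim
  filter_upwards [eventually_gt_atTop 0] with L hL
  have hcenter : ∑ j ∈ Finset.range L, richardsonWeight ρ L j * a j - J =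
      ∑ j ∈ Finset.range L, richardsonWeight ρ L j * (a j - J) := by
    simp only [mul_sub, Finset.sum_sub_distrib, ← Finset.sum_mul, sum_richardsonWeight h0 h1 hL,
      one_mul]
  rw [hcenter, ← Finset.sum_range_reflect (fun i => ρ ^ i * ‖a (L - 1 - i) - J‖), Finset.mul_sum]
  refine (norm_sum_le _ _).trans (Finset.sum_le_sum fun j hj => ?_)
  have hjL := Finset.mem_range.1 hj
  rw [norm_mul, show L - 1 - (L - 1 - j) = j by omega, ← mul_assoc]
  exact mul_le_mul_of_nonneg_right (hw L j hjL) (norm_nonneg _)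

variable {α : ℝ} {M : ℕ}

lemma natCast_rpow_neg_mem_Ioo (hα : 0 < α) (hM : 2 ≤ M) :
    (M : ℝ) ^ (-α) ∈ Set.Ioo (0 : ℝ) 1 :=
  ⟨by positivity, Real.rpow_lt_one_of_one_lt_of_neg (by exact_mod_cast hM) (by linarith)⟩

lemma vandermondeMatrix_eq_transpose (α : ℝ) (M L : ℕ) : vandermondeMatrix α M L =
    (Matrix.vandermonde fun j : Fin L => ((M : ℝ) ^ (-α)) ^ (j : ℕ)).transpose := by
  ext i j
  rw [vandermondeMatrix, Matrix.of_apply, Matrix.transpose_apply, Matrix.vandermonde_apply]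
  simp only [← Real.rpow_natCast, ← Real.rpow_mul M.cast_nonneg]
  congr 1
  ring

lemma weight_eq_richardsonWeight (hα : 0 < α) (hM : 2 ≤ M) (L : ℕ) :
    weight α M L = fun l : Fin L => richardsonWeight ((M : ℝ) ^ (-α)) L l := by
  obtain ⟨h0, h1⟩ := natCast_rpow_neg_mem_Ioo hα hM
  have hdet : IsUnit (vandermondeMatrix α M L).det := by
    rw [vandermondeMatrix_eq_transpose, Matrix.det_transpose, isUnit_iff_ne_zero]
    exact Matrix.det_vandermonde_ne_zero_iff.2
      ((pow_right_injective₀ h0 h1.ne).comp Fin.val_injective)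
  have hsol : (vandermondeMatrix α M L).mulVec
      (fun l : Fin L => richardsonWeight ((M : ℝ) ^ (-α)) L l) =
      fun i : Fin L => if (i : ℕ) = 0 then (1 : ℝ) else 0 := by
    ext i
    rw [← sum_richardsonWeight_mul_pow h0 h1 i.2, vandermondeMatrix_eq_transpose]
    exact Fin.sum_univ_eq_sum_range
      (fun l => (((M : ℝ) ^ (-α)) ^ l) ^ (i : ℕ) * richardsonWeight ((M : ℝ) ^ (-α)) L l) L
  rw [weight, ← hsol, Matrix.mulVec_mulVec, Matrix.nonsing_inv_mul _ hdet, Matrix.one_mulVec]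

lemma cumWeight_eq_sum_richardsonWeight (hα : 0 < α) (hM : 2 ≤ M) (L l : ℕ) :
    cumWeight α M L l = ∑ j ∈ Finset.Ico l L, richardsonWeight ((M : ℝ) ^ (-α)) L j := by
  rw [cumWeight, weight_eq_richardsonWeight hα hM, Fin.sum_univ_eq_sum_range
    (fun j => if l ≤ j then richardsonWeight ((M : ℝ) ^ (-α)) L j else 0), ← Finset.sum_filter]
  congr 1
  ext j
  simp only [Finset.mem_filter, Finset.mem_range, Finset.mem_Ico, and_comm]

lemma cumWeight_zero (hα : 0 < α) (hM : 2 ≤ M) {L : ℕ} (hL : 0 < L) : cumWeight α M L 0 = 1 := by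
  obtain ⟨h0, h1⟩ := natCast_rpow_neg_mem_Ioo hα hM
  rw [cumWeight_eq_sum_richardsonWeight hα hM, ← Finset.range_eq_Ico, sum_richardsonWeight h0 h1 hL]

lemma exists_abs_cumWeight_le (hα : 0 < α) (hM : 2 ≤ M) :
    ∃ C : ℝ, ∀ L l : ℕ, |cumWeight α M L l| ≤ C := by
  obtain ⟨h0, h1⟩ := natCast_rpow_neg_mem_Ioo hα hM
  simpa only [cumWeight_eq_sum_richardsonWeight hα hM] using
    exists_abs_sum_richardsonWeight_le h0 h1

lemma tendsto_sum_cumWeight_mul_levelDiff (hα : 0 < α) (hM : 2 ≤ M) {a : ℕ → ℝ} {J : ℝ}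
    (ha : Tendsto a atTop (𝓝 J)) :
    Tendsto (fun L : ℕ => ∑ l ∈ Finset.range L, cumWeight α M L l * levelDiff a l) atTop
      (𝓝 J) := by
  obtain ⟨h0, h1⟩ := natCast_rpow_neg_mem_Ioo hα hM
  simpa only [cumWeight_eq_sum_richardsonWeight hα hM, sum_tail_mul_levelDiff] using
    tendsto_sum_richardsonWeight_mul h0 h1 ha

end Weights

/-! ### Growth of the number of levels and of the sample sizes -/

lemma tendsto_sqrt_add_log_div {A d : ℝ} (hA : 0 < A) (hd : 0 < d) (a : ℝ) :
    Tendsto (fun ε => √(a + 2 * Real.log (A / ε) / d)) (𝓝[>] 0) atTop := by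
  refine Real.tendsto_sqrt_atTop.comp (tendsto_atTop_add_const_left _ _
    (Tendsto.atTop_div_const hd (Tendsto.const_mul_atTop two_pos ?_)))
  exact Real.tendsto_log_atTop.comp (tendsto_inv_nhdsGT_zero.const_mul_atTop hA)

namespace Params

variable {r : Params}

lemma alpha_mul_log_pos (hM : 2 ≤ r.M) (hα : 0 < r.α) : 0 < r.α * Real.log r.M :=
  mul_pos hα (Real.log_pos (by exact_mod_cast hM))

lemma tendsto_numLevels (hM : 2 ≤ r.M) (hα : 0 < r.α) (hA : 0 < r.A) :
    Tendsto r.numLevels (𝓝[>] 0) atTop :=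
  tendsto_nat_ceil_atTop.comp (tendsto_atTop_add_const_left _ _
    (tendsto_sqrt_add_log_div hA (alpha_mul_log_pos hM hα) _))

lemma tendsto_rpow_mul_exp_numLevels (hM : 2 ≤ r.M) (hα : 0 < r.α) (hA : 0 < r.A)
    {δ : ℝ} (hδ : 0 < δ) (κ : ℝ) :
    Tendsto (fun ε => ε ^ δ * Real.exp (κ * r.numLevels ε)) (𝓝[>] 0) (𝓝 0) := by
  set a : ℝ := 1 / 2 + Real.log (r.c ^ (1 / r.α) * r.hbar) / Real.log r.M
  set d : ℝ := r.α * Real.log r.M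
  have hd0 : 0 < d := alpha_mul_log_pos hM hα
  set z : ℝ → ℝ := fun ε => √(a ^ 2 + 2 * Real.log (r.A / ε) / d) with hz
  have hz_lim : Tendsto z (𝓝[>] 0) atTop := tendsto_sqrt_add_log_div hA hd0 _
  set c₀ : ℝ := |κ| * (|a| + 1) + δ * (Real.log r.A + d * a ^ 2 / 2)
  have hquad : Tendsto (fun ε => c₀ + z ε * (|κ| + -(δ * d / 2) * z ε)) (𝓝[>] 0) atBot :=
    tendsto_atBot_add_const_left _ _ (hz_lim.atTop_mul_atBot₀ (tendsto_atBot_add_const_left _ _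
      (hz_lim.const_mul_atTop_of_neg (neg_lt_zero.2 (by positivity)))))
  refine squeeze_zero' ?_ ?_ (Real.tendsto_exp_atBot.comp hquad)
  · filter_upwards [self_mem_nhdsWithin] with ε hε
    exact mul_nonneg (Real.rpow_nonneg (le_of_lt hε) _) (Real.exp_pos _).le
  · filter_upwards [self_mem_nhdsWithin, hz_lim.eventually_gt_atTop 0] with ε hε hzε
    have hε : 0 < ε := hε
    have hzsq : z ε ^ 2 = a ^ 2 + 2 * (Real.log r.A - Real.log ε) / d := by
      rw [hz, Real.sq_sqrt (Real.sqrt_pos.1 hzε).le, Real.log_div hA.ne' hε.ne']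
    have hlog : Real.log ε = Real.log r.A + d * a ^ 2 / 2 - d / 2 * z ε ^ 2 := by
      rw [hzsq]
      field_simp
      ring
    have hnum : (r.numLevels ε : ℝ) ≤ |a| + z ε + 1 :=
      (Nat.cast_le.2 (Nat.ceil_mono (by gcongr; exact le_abs_self a))).trans
        (Nat.ceil_lt_add_one (by positivity)).le
    have hκ : κ * r.numLevels ε ≤ |κ| * (|a| + z ε + 1) := by
      gcongr
      exact le_abs_self κ
    rw [Real.rpow_def_of_pos hε, ← Real.exp_add, Function.comp_apply, Real.exp_le_exp, hlog]
    calc (Real.log r.A + d * a ^ 2 / 2 - d / 2 * z ε ^ 2) * δ + κ * r.numLevels ε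
        ≤ (Real.log r.A + d * a ^ 2 / 2 - d / 2 * z ε ^ 2) * δ + |κ| * (|a| + z ε + 1) := by
          gcongr
      _ = c₀ + z ε * (|κ| + -(δ * d / 2) * z ε) := by ring

lemma hbar_pos (hT : 0 < r.T) (hm : 1 ≤ r.m) : 0 < r.hbar :=
  div_pos (by exact_mod_cast hT) (by exact_mod_cast hm)

lemma lowC_pos (r : Params) : 0 < r.lowC := by
  unfold lowC
  positivity

lemma alloc_nonneg (hT : 0 < r.T) (hm : 1 ≤ r.m) (L l : ℕ) : 0 ≤ r.alloc L l := by
  have := hbar_pos hT hm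
  have : 0 ≤ r.lam := Real.sqrt_nonneg _
  have := r.lowC_pos
  unfold alloc
  split_ifs <;> positivity

lemma one_le_alloc_zero (hT : 0 < r.T) (hm : 1 ≤ r.m) (L : ℕ) : 1 ≤ r.alloc L 0 := by
  have := hbar_pos hT hm
  have : 0 ≤ r.lam := Real.sqrt_nonneg _
  rw [alloc, if_pos rfl, le_add_iff_nonneg_right]
  positivity

lemma qstar_pos (hT : 0 < r.T) (hm : 1 ≤ r.m) {L : ℕ} (hL : 0 < L) : 0 < r.qstar L :=
  inv_pos.2 <| (one_pos.trans_le (one_le_alloc_zero hT hm L)).trans_le <|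
    Finset.single_le_sum (f := r.alloc L) (fun l _ => alloc_nonneg hT hm L l)
      (Finset.mem_range.2 hL)

lemma le_levelN (hT : 0 < r.T) (hm : 1 ≤ r.m) (hα : 0 < r.α) (hvar : 0 < r.varP) {ε : ℝ}
    (hL : 0 < r.numLevels ε) (l : ℕ) :
    r.varP * r.alloc (r.numLevels ε) l / ε ^ 2 ≤ r.levelN ε l := by
  refine le_trans ?_ (Nat.le_ceil _)
  have hq := qstar_pos hT hm hL
  have := hbar_pos hT hm
  have : 0 ≤ r.lam := Real.sqrt_nonneg _
  have : 0 ≤ r.upC := by unfold upC; positivity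
  have := alloc_nonneg hT hm (r.numLevels ε) l
  set s : ℝ := r.lam * r.hbar ^ (r.β / 2)
      + r.lam * r.hbar ^ (r.β / 2) * r.upC * ∑ l ∈ Finset.Ico 1 (r.numLevels ε),
          |cumWeight r.α r.M (r.numLevels ε) l| * (r.M : ℝ) ^ ((1 - r.β) / 2 * l) with hs
  have hs0 : 0 ≤ s := by positivity
  have htot : r.totalN ε * r.mu (r.numLevels ε) l = ((1 + 1 / (2 * r.α * r.numLevels ε)) *
      (1 + s)) * (r.varP * r.alloc (r.numLevels ε) l / ε ^ 2) := by
    rw [totalN, mu, add_assoc (1 : ℝ), ← hs]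
    field_simp
  rw [htot]
  exact le_mul_of_one_le_left (by positivity) (one_le_mul_of_one_le_of_one_le
    (le_add_of_nonneg_right (by positivity)) (le_add_of_nonneg_right hs0))

lemma exists_le_levelN (hT : 0 < r.T) (hM : 2 ≤ r.M) (hm : 1 ≤ r.m) (hα : 0 < r.α)
    (hV₁ : 0 < r.V₁) (hvar : 0 < r.varP) :
    ∃ c κ : ℝ, 0 < c ∧ ∀ ε : ℝ, 0 < r.numLevels ε → ∀ l : ℕ,
      c * |cumWeight r.α r.M (r.numLevels ε) l| * Real.exp (-(κ * l)) / ε ^ 2 ≤ r.levelN ε l := by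
  have := hbar_pos hT hm
  have hlam : 0 < r.lam := Real.sqrt_pos.2 (by positivity)
  have := r.lowC_pos
  set c₁ : ℝ := r.lam * r.hbar ^ (r.β / 2) * r.lowC with hc₁
  have : 0 < c₁ := by positivity
  refine ⟨r.varP * min 1 c₁, Real.log r.M * ((1 + r.β) / 2), by positivity,
    fun ε hL l => (le_levelN hT hm hα hvar hL l).trans' ?_⟩
  rw [mul_assoc, mul_assoc]
  gcongr
  rcases l.eq_zero_or_pos with rfl | hl
  · refine le_trans ?_ (one_le_alloc_zero hT hm _)
    simp [cumWeight_zero hα hM hL]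
  · rw [alloc, if_neg hl.ne', ← hc₁, Real.rpow_def_of_pos (by positivity),
      show Real.log r.M * (-((1 + r.β) / 2) * l) = -(Real.log r.M * ((1 + r.β) / 2) * l) by ring,
      ← mul_assoc]
    gcongr
    exact min_le_right _ _

end Params

/-! ### Sums of martingale differences -/

section MartingaleDifference

lemma abs_one_add_rpow_le {s : ℝ} (hs1 : 1 ≤ s) (hs2 : s ≤ 2) (t : ℝ) :
    |1 + t| ^ s ≤ 1 + s * t + 6 * |t| ^ s := by
  have hnonneg : 0 ≤ |t| ^ s := by positivity
  rcases le_or_gt |t| 1 with ht | ht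
  · have ht1 : -1 ≤ t := (abs_le.1 ht).1
    have hsq : t ^ 2 ≤ |t| ^ s := by
      simpa using Real.rpow_le_rpow_of_exponent_ge' (abs_nonneg t) ht (by linarith) hs2
    rw [abs_of_nonneg (by linarith)]
    calc (1 + t) ^ s = (1 + t) * (1 + t) ^ (s - 1) := by
          rw [mul_comm, ← Real.rpow_add_one' (by linarith) (by linarith), sub_add_cancel]
      _ ≤ (1 + t) * (1 + (s - 1) * t) := by
          gcongr
          · linarith
          · exact rpow_one_add_le_one_add_mul_self ht1 (by linarith) (by linarith)
      _ ≤ 1 + s * t + 6 * |t| ^ s := by nlinarith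
  · have habs : |1 + t| ≤ 2 * |t| := (abs_add_le 1 t).trans (by rw [abs_one]; linarith)
    have hself : |t| ≤ |t| ^ s := Real.self_le_rpow_of_one_le ht.le hs1
    have h4 : (2 : ℝ) ^ s ≤ 4 := by
      simpa using (Real.rpow_le_rpow_of_exponent_le one_le_two hs2).trans_eq (by norm_num)
    have hst : -(2 * |t|) ≤ s * t := by nlinarith [neg_abs_le t, abs_nonneg t]
    calc |1 + t| ^ s ≤ (2 * |t|) ^ s := by gcongr
      _ = 2 ^ s * |t| ^ s := Real.mul_rpow zero_le_two (abs_nonneg t)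
      _ ≤ 4 * |t| ^ s := by gcongr
      _ ≤ 1 + s * t + 6 * |t| ^ s := by linarith

-- `|x| ^ s / x` is the derivative of `|x| ^ s / s`.
lemma abs_add_rpow_le {s : ℝ} (hs1 : 1 ≤ s) (hs2 : s ≤ 2) (x y : ℝ) :
    |x + y| ^ s ≤ |x| ^ s + s * (|x| ^ s / x * y) + 6 * |y| ^ s := by
  rcases eq_or_ne x 0 with rfl | hx
  · have : 0 ≤ |y| ^ s := by positivity
    simp only [zero_add, div_zero, zero_mul, mul_zero, add_zero, abs_zero,
      Real.zero_rpow (show s ≠ 0 by linarith)]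
    linarith
  · calc |x + y| ^ s = |x| ^ s * |1 + y / x| ^ s := by
          rw [← Real.mul_rpow (abs_nonneg _) (abs_nonneg _), ← abs_mul]
          congr 2
          field_simp
      _ ≤ |x| ^ s * (1 + s * (y / x) + 6 * |y / x| ^ s) := by
          gcongr
          exact abs_one_add_rpow_le hs1 hs2 _
      _ = |x| ^ s + s * (|x| ^ s / x * y) + 6 * |y| ^ s := by
          rw [abs_div, Real.div_rpow (abs_nonneg _) (abs_nonneg _)]
          field_simp

lemma abs_rpow_div_mul_le {s : ℝ} (hs : 1 ≤ s) (x y : ℝ) :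
    |(|x| ^ s / x * y)| ≤ |x| ^ s + |y| ^ s := by
  rcases eq_or_ne x 0 with rfl | hx
  · simp only [div_zero, zero_mul, abs_zero]
    positivity
  have hsplit (z : ℝ) (hz : 0 < |z|) : |z| ^ s = |z| ^ (s - 1) * |z| := by
    rw [← Real.rpow_add_one hz.ne', sub_add_cancel]
  have hx0 := abs_pos.2 hx
  rw [abs_mul, abs_div, abs_of_nonneg (show 0 ≤ |x| ^ s by positivity), hsplit x hx0,
    mul_div_cancel_right₀ _ hx0.ne']
  rcases le_or_gt |y| |x| with hyx | hxy
  · exact (mul_le_mul_of_nonneg_left hyx (by positivity)).trans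
      (le_add_of_nonneg_right (by positivity))
  · rw [hsplit y (hx0.trans hxy)]
    refine (mul_le_mul_of_nonneg_right (Real.rpow_le_rpow hx0.le hxy.le (by linarith))
      (abs_nonneg y)).trans (le_add_of_nonneg_left (by positivity))

lemma abs_sum_range_succ_mul_le {b x : ℕ → ℝ} {K : ℝ} (hb : Monotone b) (hb0 : 0 ≤ b 0)
    (hx : ∀ n, |∑ k ∈ Finset.range n, x k| ≤ K) (n : ℕ) :
    |∑ k ∈ Finset.range (n + 1), b k * x k| ≤ 2 * K * b n := by
  have hparts := Finset.sum_range_by_parts b x (n + 1)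
  simp only [smul_eq_mul, add_tsub_cancel_right] at hparts
  have hbn : 0 ≤ b n := hb0.trans (hb n.zero_le)
  rw [hparts]
  calc |b n * ∑ i ∈ Finset.range (n + 1), x i
        - ∑ i ∈ Finset.range n, (b (i + 1) - b i) * ∑ j ∈ Finset.range (i + 1), x j|
      ≤ b n * K + ∑ i ∈ Finset.range n, (b (i + 1) - b i) * K := by
        refine (abs_sub _ _).trans (add_le_add ?_ ((Finset.abs_sum_le_sum_abs _ _).trans
          (Finset.sum_le_sum fun i _ => ?_)))
        · rw [abs_mul, abs_of_nonneg hbn]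
          exact mul_le_mul_of_nonneg_left (hx _) hbn
        · have hbi : 0 ≤ b (i + 1) - b i := sub_nonneg.2 (hb i.le_succ)
          rw [abs_mul, abs_of_nonneg hbi]
          exact mul_le_mul_of_nonneg_left (hx _) hbi
    _ = b n * K + (b n - b 0) * K := by rw [← Finset.sum_mul, Finset.sum_range_sub]
    _ ≤ 2 * K * b n := by nlinarith [(abs_nonneg _).trans (hx 0)]

variable {Ω : Type*} {mΩ : MeasurableSpace Ω} {μ : Measure Ω}

variable {s : ℝ}

lemma integrable_abs_rpow {f : Ω → ℝ} (hs : 0 < s) (hf : MemLp f (ENNReal.ofReal s) μ) :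
    Integrable (fun ω => |f ω| ^ s) μ := by
  simpa [ENNReal.toReal_ofReal hs.le] using
    hf.integrable_norm_rpow (by simpa using hs) ENNReal.ofReal_ne_top

lemma integral_abs_le_one_add [IsProbabilityMeasure μ] {f : Ω → ℝ} (hs : 1 ≤ s)
    (hf : MemLp f (ENNReal.ofReal s) μ) : ∫ ω, |f ω| ∂μ ≤ 1 + ∫ ω, |f ω| ^ s ∂μ := by
  have hint := integrable_abs_rpow (by linarith) hf
  calc ∫ ω, |f ω| ∂μ ≤ ∫ ω, 1 + |f ω| ^ s ∂μ := by
        refine integral_mono (hf.integrable (by simpa using hs)).abs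
          ((integrable_const 1).add hint) fun ω => ?_
        rcases le_total |f ω| 1 with h | h
        · exact h.trans (le_add_of_nonneg_right (by positivity))
        · exact (Real.self_le_rpow_of_one_le h hs).trans (le_add_of_nonneg_left zero_le_one)
    _ = 1 + ∫ ω, |f ω| ^ s ∂μ := by rw [integral_add (integrable_const 1) hint]; simp

/-- `D` is a sequence of martingale differences: `D k` is the increment from time `k` to time
`k + 1` of a martingale for the filtration `ℱ`. -/
structure IsMartingaleDifference (ℱ : Filtration ℕ mΩ) (D : ℕ → Ω → ℝ) (μ : Measure Ω) :
    Prop where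
  stronglyMeasurable : ∀ k, StronglyMeasurable[ℱ (k + 1)] (D k)
  integrable : ∀ k, Integrable (D k) μ
  condExp_eq_zero : ∀ k, μ[D k | ℱ k] =ᵐ[μ] 0

namespace IsMartingaleDifference

variable {ℱ : Filtration ℕ mΩ} {D : ℕ → Ω → ℝ}

lemma const_mul (h : IsMartingaleDifference ℱ D μ) (c : ℕ → ℝ) :
    IsMartingaleDifference ℱ (fun k ω => c k * D k ω) μ where
  stronglyMeasurable k := (h.stronglyMeasurable k).const_mul (c k)
  integrable k := (h.integrable k).const_mul (c k)
  condExp_eq_zero k := by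
    filter_upwards [condExp_smul (c k) (D k) (ℱ k), h.condExp_eq_zero k] with ω hsmul hzero
    refine hsmul.trans ?_
    rw [Pi.smul_apply, hzero, Pi.zero_apply, smul_zero]

lemma stronglyMeasurable_sum (h : IsMartingaleDifference ℱ D μ) (n : ℕ) :
    StronglyMeasurable[ℱ n] fun ω => ∑ k ∈ Finset.range n, D k ω :=
  Finset.stronglyMeasurable_fun_sum _ fun k hk =>
    (h.stronglyMeasurable k).mono (ℱ.mono (Finset.mem_range.1 hk))

lemma martingale_sum [IsFiniteMeasure μ] (h : IsMartingaleDifference ℱ D μ) :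
    Martingale (fun n ω => ∑ k ∈ Finset.range n, D k ω) ℱ μ := by
  refine martingale_of_condExp_sub_eq_zero_nat h.stronglyMeasurable_sum
    (fun n => integrable_finsetSum _ fun k _ => h.integrable k) fun n => ?_
  have hdiff : (fun ω => ∑ k ∈ Finset.range (n + 1), D k ω) -
      (fun ω => ∑ k ∈ Finset.range n, D k ω) = D n := by
    ext ω
    rw [Pi.sub_apply, Finset.sum_range_succ, add_sub_cancel_left]
  rw [hdiff]
  exact h.condExp_eq_zero n

lemma integral_mul_eq_zero [IsFiniteMeasure μ] (h : IsMartingaleDifference ℱ D μ) {k : ℕ}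
    {g : Ω → ℝ} (hg : StronglyMeasurable[ℱ k] g) (hgD : Integrable (fun ω => g ω * D k ω) μ) :
    ∫ ω, g ω * D k ω ∂μ = 0 := by
  have hcond : μ[g * D k | ℱ k] =ᵐ[μ] 0 := by
    filter_upwards [condExp_mul_of_stronglyMeasurable_left hg hgD (h.integrable k),
      h.condExp_eq_zero k] with ω hmul hzero
    rw [hmul, Pi.mul_apply, hzero, Pi.zero_apply, mul_zero]
  calc ∫ ω, g ω * D k ω ∂μ = ∫ ω, (μ[g * D k | ℱ k]) ω ∂μ := (integral_condExp (ℱ.le k)).symm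
    _ = 0 := by rw [integral_congr_ae hcond]; simp

/-- The von Bahr–Esseen inequality. -/
theorem integral_abs_sum_rpow_le [IsFiniteMeasure μ] (h : IsMartingaleDifference ℱ D μ)
    (hs1 : 1 ≤ s) (hs2 : s ≤ 2) (hD : ∀ k, MemLp (D k) (ENNReal.ofReal s) μ) (n : ℕ) :
    ∫ ω, |∑ k ∈ Finset.range n, D k ω| ^ s ∂μ ≤
      6 * ∑ k ∈ Finset.range n, ∫ ω, |D k ω| ^ s ∂μ := by
  have hs0 : 0 < s := by linarith
  induction n with
  | zero => simp [Real.zero_rpow hs0.ne']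
  | succ n ih =>
    set S : Ω → ℝ := fun ω => ∑ k ∈ Finset.range n, D k ω
    have hS : Integrable (fun ω => |S ω| ^ s) μ :=
      integrable_abs_rpow hs0 (memLp_finsetSum _ fun k _ => hD k)
    have hDn := integrable_abs_rpow hs0 (hD n)
    have hg : StronglyMeasurable[ℱ n] fun ω => |S ω| ^ s / S ω :=
      ((show Measurable fun x : ℝ => |x| ^ s / x by fun_prop).comp
        (h.stronglyMeasurable_sum n).measurable).stronglyMeasurable
    have hgD : Integrable (fun ω => |S ω| ^ s / S ω * D n ω) μ :=
      (hS.add hDn).mono' ((hg.mono (ℱ.le n)).aestronglyMeasurable.mul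
        (h.integrable n).aestronglyMeasurable) (.of_forall fun ω => abs_rpow_div_mul_le hs1 _ _)
    calc ∫ ω, |∑ k ∈ Finset.range (n + 1), D k ω| ^ s ∂μ
        ≤ ∫ ω, |S ω| ^ s + s * (|S ω| ^ s / S ω * D n ω) + 6 * |D n ω| ^ s ∂μ := by
          refine integral_mono (integrable_abs_rpow hs0 (memLp_finsetSum _ fun k _ => hD k))
            ((hS.fun_add (hgD.const_mul s)).fun_add (hDn.const_mul 6)) fun ω => ?_
          simp only [Finset.sum_range_succ]
          exact abs_add_rpow_le hs1 hs2 _ _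
      _ = ∫ ω, |S ω| ^ s ∂μ + 6 * ∫ ω, |D n ω| ^ s ∂μ := by
          rw [integral_add (hS.fun_add (hgD.const_mul s)) (hDn.const_mul 6),
            integral_add hS (hgD.const_mul s), integral_const_mul, integral_const_mul,
            h.integral_mul_eq_zero hg hgD, mul_zero, add_zero]
      _ ≤ 6 * ∑ k ∈ Finset.range (n + 1), ∫ ω, |D k ω| ^ s ∂μ := by
          rw [Finset.sum_range_succ, mul_add]
          gcongr

end IsMartingaleDifference

lemma measure_exists_le_abs_martingale_le [IsFiniteMeasure μ] {ℱ : Filtration ℕ mΩ}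
    {f : ℕ → Ω → ℝ} (hf : Martingale f ℱ μ) {A : ℝ} (hA : ∀ n, ∫ ω, |f n ω| ∂μ ≤ A) {t : ℝ}
    (ht : 0 < t) : μ {ω | ∃ n, t ≤ |f n ω|} ≤ ENNReal.ofReal (A / t) := by
  have hsub : Submartingale (fun n ω => |f n ω|) ℱ μ := hf.submartingale.sup hf.neg.submartingale
  set S : ℕ → Set Ω := fun n =>
    {ω | ((t.toNNReal : ℝ≥0) : ℝ) ≤
      (Finset.range (n + 1)).sup' Finset.nonempty_range_add_one fun k => |f k ω|} with hS
  have hmem (n : ℕ) (ω : Ω) : ω ∈ S n ↔ ∃ k ≤ n, t ≤ |f k ω| := by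
    simp only [hS, Set.mem_ofPred_eq, Real.coe_toNNReal t ht.le, Finset.le_sup'_iff,
      Finset.mem_range_succ_iff]
  have hunion : {ω | ∃ n, t ≤ |f n ω|} = ⋃ n, S n := by
    ext ω
    simp only [Set.mem_ofPred_eq, Set.mem_iUnion, hmem]
    exact ⟨fun ⟨n, hn⟩ => ⟨n, n, le_rfl, hn⟩, fun ⟨_, k, _, hk⟩ => ⟨k, hk⟩⟩
  have hmono : Monotone S := fun m n hmn ω hω => by
    obtain ⟨k, hk, hle⟩ := (hmem m ω).1 hω
    exact (hmem n ω).2 ⟨k, hk.trans hmn, hle⟩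
  rw [hunion, hmono.measure_iUnion]
  refine iSup_le fun n => ?_
  rw [ENNReal.ofReal_div_of_pos ht, ENNReal.le_div_iff_mul_le
    (.inl (by simpa using ht)) (.inl ENNReal.ofReal_ne_top), mul_comm]
  refine (maximal_ineq hsub (fun _ _ => abs_nonneg _) n).trans (ENNReal.ofReal_le_ofReal ?_)
  exact (setIntegral_le_integral (hsub.integrable n) (.of_forall fun _ => abs_nonneg _)).trans
    (hA n)

lemma ae_exists_forall_le_mul_two_pow {X : ℕ → ℕ → Ω → ℝ} {A : ℝ}
    (hX : ∀ l, ∀ t : ℝ, 0 < t → μ {ω | ∃ n, t ≤ X l n ω} ≤ ENNReal.ofReal (A / t)) :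
    ∀ᵐ ω ∂μ, ∃ K : ℝ, ∀ l n, X l n ω ≤ K * 2 ^ l := by
  have hbound (R : ℕ) : μ {ω | ¬ ∃ K : ℝ, ∀ l n, X l n ω ≤ K * 2 ^ l} ≤
      ENNReal.ofReal (A / (R + 1 : ℕ)) * 2 := by
    have hsubset : {ω | ¬ ∃ K : ℝ, ∀ l n, X l n ω ≤ K * 2 ^ l} ⊆
        ⋃ l : ℕ, {ω | ∃ n, (R + 1 : ℕ) * 2 ^ l ≤ X l n ω} := fun ω hω => by
      simp only [Set.mem_ofPred_eq, not_exists, not_forall, not_le] at hω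
      obtain ⟨l, n, hln⟩ := hω (R + 1 : ℕ)
      exact Set.mem_iUnion.2 ⟨l, n, hln.le⟩
    calc μ {ω | ¬ ∃ K : ℝ, ∀ l n, X l n ω ≤ K * 2 ^ l}
        ≤ ∑' l : ℕ, μ {ω | ∃ n, (R + 1 : ℕ) * 2 ^ l ≤ X l n ω} :=
          (measure_mono hsubset).trans (measure_iUnion_le _)
      _ ≤ ∑' l : ℕ, ENNReal.ofReal (A / (R + 1 : ℕ)) * 2⁻¹ ^ l := by
          refine ENNReal.tsum_le_tsum fun l => (hX l _ (by positivity)).trans_eq ?_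
          rw [← div_div, ENNReal.ofReal_div_of_pos (by positivity),
            div_eq_mul_inv _ (ENNReal.ofReal _), ENNReal.ofReal_pow zero_le_two,
            ENNReal.ofReal_ofNat, ENNReal.inv_pow]
      _ = ENNReal.ofReal (A / (R + 1 : ℕ)) * 2 := by
          rw [ENNReal.tsum_mul_left, ENNReal.tsum_geometric, ENNReal.one_sub_inv_two, inv_inv]
  have hlim : Tendsto (fun R : ℕ => ENNReal.ofReal (A / (R + 1 : ℕ)) * 2) atTop (𝓝 0) := by
    simpa using ENNReal.Tendsto.mul_const (b := 2) (ENNReal.tendsto_ofReal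
      ((tendsto_const_div_atTop_nhds_zero_nat A).comp (tendsto_add_atTop_nat 1))) (.inr (by simp))
  exact nonpos_iff_eq_zero.1 (ge_of_tendsto' hlim hbound)

-- Kronecker's argument: `M n = ∑ k < n, (k + 1) ^ (-γ) D k` is an `L ^ s`-bounded martingale, hence
-- almost surely bounded, and summation by parts bounds the unweighted sums by `2 n ^ γ sup |M|`.
theorem ae_exists_forall_abs_sum_le [IsProbabilityMeasure μ] {ℱ : ℕ → Filtration ℕ mΩ}
    {D : ℕ → ℕ → Ω → ℝ} {s γ C : ℝ} (hs1 : 1 ≤ s) (hs2 : s ≤ 2) (hγ0 : 0 ≤ γ) (hγs : 1 < γ * s)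
    (hD : ∀ l, IsMartingaleDifference (ℱ l) (D l) μ)
    (hLp : ∀ l k, MemLp (D l k) (ENNReal.ofReal s) μ) (hC : ∀ l k, ∫ ω, |D l k ω| ^ s ∂μ ≤ C) :
    ∀ᵐ ω ∂μ, ∃ K : ℝ, ∀ l n : ℕ, |∑ k ∈ Finset.range n, D l k ω| ≤ K * 2 ^ l * (n : ℝ) ^ γ := by
  set c : ℕ → ℝ := fun k => ((k + 1 : ℕ) : ℝ) ^ (-γ)
  set M : ℕ → ℕ → Ω → ℝ := fun l n ω => ∑ k ∈ Finset.range n, c k * D l k ω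
  have hmart (l : ℕ) := ((hD l).const_mul c).martingale_sum
  have hcLp (l k : ℕ) : MemLp (fun ω => c k * D l k ω) (ENNReal.ofReal s) μ :=
    (hLp l k).const_mul (c k)
  have hC0 : 0 ≤ C := (integral_nonneg fun _ => by positivity).trans (hC 0 0)
  have hsummable : Summable fun k : ℕ => ((k + 1 : ℕ) : ℝ) ^ (-(γ * s)) :=
    (summable_nat_add_iff 1).2 (Real.summable_nat_rpow.2 (by linarith))
  have hmoment (l k : ℕ) : ∫ ω, |c k * D l k ω| ^ s ∂μ ≤ ((k + 1 : ℕ) : ℝ) ^ (-(γ * s)) * C := by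
    have hfactor (ω : Ω) :
        |c k * D l k ω| ^ s = ((k + 1 : ℕ) : ℝ) ^ (-(γ * s)) * |D l k ω| ^ s := by
      rw [abs_mul, Real.mul_rpow (abs_nonneg _) (abs_nonneg _), abs_of_nonneg (by positivity),
        ← Real.rpow_mul (by positivity), neg_mul]
    simp only [hfactor, integral_const_mul]
    exact mul_le_mul_of_nonneg_left (hC l k) (by positivity)
  have hL1 (l n : ℕ) : ∫ ω, |M l n ω| ∂μ ≤
      1 + 6 * ((∑' k : ℕ, ((k + 1 : ℕ) : ℝ) ^ (-(γ * s))) * C) := by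
    refine (integral_abs_le_one_add hs1 (memLp_finsetSum _ fun k _ => hcLp l k)).trans ?_
    gcongr
    refine (((hD l).const_mul c).integral_abs_sum_rpow_le hs1 hs2 (hcLp l) n).trans ?_
    gcongr
    refine (Finset.sum_le_sum fun k _ => hmoment l k).trans ?_
    rw [← Finset.sum_mul]
    gcongr
    exact hsummable.sum_le_tsum _ fun k _ => by positivity
  filter_upwards [ae_exists_forall_le_mul_two_pow fun l t ht =>
    measure_exists_le_abs_martingale_le (hmart l) (hL1 l) ht] with ω ⟨K, hK⟩
  refine ⟨2 * K, fun l n => ?_⟩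
  rcases n with _ | n
  · have hK0 : 0 ≤ K := by simpa using hK 0 0
    simp only [Finset.range_zero, Finset.sum_empty, abs_zero]
    positivity
  · have hb : Monotone fun k : ℕ => ((k + 1 : ℕ) : ℝ) ^ γ := fun i j hij => by
      dsimp only
      gcongr
    have hcancel (k : ℕ) : ((k + 1 : ℕ) : ℝ) ^ γ * (c k * D l k ω) = D l k ω := by
      rw [← mul_assoc, ← Real.rpow_add (by positivity), add_neg_cancel, Real.rpow_zero, one_mul]
    simpa only [hcancel, mul_assoc] using
      abs_sum_range_succ_mul_le hb (by positivity) (hK l) n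

end MartingaleDifference

/-! ### Change of measure for Gaussian increments -/

section Girsanov

lemma lintegral_pi_prod {ι : Type*} [Fintype ι] {X : ι → Type*} [∀ i, MeasurableSpace (X i)]
    (μ : ∀ i, Measure (X i)) [∀ i, IsProbabilityMeasure (μ i)] {f : ∀ i, X i → ℝ≥0∞}
    (hf : ∀ i, Measurable (f i)) :
    ∫⁻ x, ∏ i, f i (x i) ∂(Measure.pi μ) = ∏ i, ∫⁻ x, f i x ∂(μ i) := by
  rw [lintegral_prod_eq_prod_lintegral_of_indepFun Finset.univ
    (fun i (x : ∀ i, X i) => f i (x i)) (iIndepFun_pi fun i => (hf i).aemeasurable)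
    fun i => (hf i).comp (measurable_pi_apply i)]
  exact Finset.prod_congr rfl fun i _ => (measurePreserving_eval μ i).lintegral_comp (hf i)

lemma pi_withDensity_prod {ι : Type*} [Fintype ι] {X : ι → Type*} [∀ i, MeasurableSpace (X i)]
    {μ ν : ∀ i, Measure (X i)} [∀ i, IsProbabilityMeasure (μ i)] [∀ i, SigmaFinite (ν i)]
    {f : ∀ i, X i → ℝ≥0∞} (hf : ∀ i, Measurable (f i))
    (hν : ∀ i, (μ i).withDensity (f i) = ν i) :
    (Measure.pi μ).withDensity (fun x => ∏ i, f i (x i)) = Measure.pi ν := by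
  refine (Measure.pi_eq fun s hs => ?_).symm
  have hs' : MeasurableSet (Set.univ.pi s) := .univ_pi hs
  have hindicator : (Set.univ.pi s).indicator (fun x => ∏ i, f i (x i)) =
      fun x => ∏ i, (s i).indicator (f i) (x i) := by
    ext x
    by_cases hx : ∀ i, x i ∈ s i
    · rw [Set.indicator_of_mem (Set.mem_univ_pi.2 hx)]
      exact Finset.prod_congr rfl fun i _ => (Set.indicator_of_mem (hx i) _).symm
    · rw [Set.indicator_of_notMem (mt Set.mem_univ_pi.1 hx)]
      obtain ⟨i, hi⟩ := not_forall.1 hx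
      exact (Finset.prod_eq_zero (Finset.mem_univ i) (Set.indicator_of_notMem hi _)).symm
  rw [withDensity_apply _ hs', ← lintegral_indicator hs', hindicator,
    lintegral_pi_prod μ fun i => (hf i).indicator (hs i)]
  refine Finset.prod_congr rfl fun i _ => ?_
  rw [lintegral_indicator (hs i), ← withDensity_apply _ (hs i), hν i]

lemma gaussianReal_withDensity_exp {v : ℝ≥0} (hv : v ≠ 0) (c : ℝ) :
    (gaussianReal 0 v).withDensity
      (fun y => ENNReal.ofReal (Real.exp (-(c * y) - c ^ 2 * v / 2))) =
      gaussianReal (-(v * c)) v := by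
  have hv' : (v : ℝ) ≠ 0 := by exact_mod_cast hv
  rw [gaussianReal_of_var_ne_zero _ hv, gaussianReal_of_var_ne_zero _ hv,
    ← withDensity_mul _ (measurable_gaussianPDF 0 v) (by fun_prop)]
  congr 1 with y
  rw [Pi.mul_apply, gaussianPDF, gaussianPDF, ← ENNReal.ofReal_mul (gaussianPDFReal_nonneg _ _ _),
    gaussianPDFReal, gaussianPDFReal, mul_assoc, ← Real.exp_add]
  congr 3
  field_simp
  ring

variable {q n : ℕ}

/-- The law of `n` independent increments, over time steps of length `h`, of a `q`-dimensional
Brownian motion. -/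
def gridMeasure (q n : ℕ) (h : ℝ≥0) : Measure (Fin q → Fin n → ℝ) :=
  Measure.pi fun _ => Measure.pi fun _ => gaussianReal 0 h

instance (h : ℝ≥0) : IsProbabilityMeasure (gridMeasure q n h) := by
  unfold gridMeasure
  infer_instance

/-- The endpoint of the path, started at `0`, with the increments `v`. -/
def gridSum (v : Fin q → Fin n → ℝ) : E q := WithLp.toLp 2 fun j => ∑ i, v j i

/-- The increments, over time steps of length `h`, of the path with increments `v` and the
additional drift `θ`. -/
def gridShift (h : ℝ≥0) (θ : E q) (v : Fin q → Fin n → ℝ) : Fin q → Fin n → ℝ :=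
  fun j i => v j i + h * θ j

@[fun_prop]
lemma measurable_gridSum : Measurable (gridSum : (Fin q → Fin n → ℝ) → E q) :=
  (WithLp.measurable_toLp 2 _).comp (by fun_prop)

lemma measurable_gridShift (h : ℝ≥0) :
    Measurable fun z : E q × (Fin q → Fin n → ℝ) => gridShift h z.1 z.2 := by
  unfold gridShift
  fun_prop

@[fun_prop]
lemma measurable_girsanov {X : Type*} [MeasurableSpace X] (T : ℝ≥0) {f g : X → E q}
    (hf : Measurable f) (hg : Measurable g) : Measurable fun a => girsanov T (f a) (g a) := by
  unfold girsanov
  fun_prop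

lemma girsanov_pos (T : ℝ≥0) (w θ : E q) : 0 < girsanov T w θ := Real.exp_pos _

lemma girsanov_rpow (T : ℝ≥0) (w θ : E q) (a : ℝ) :
    girsanov T w θ ^ a =
      Real.exp ((a ^ 2 - a) * ‖θ‖ ^ 2 * T / 2) * girsanov T w (a • θ) := by
  rw [girsanov, girsanov, ← Real.exp_mul, ← Real.exp_add, real_inner_smul_left, norm_smul,
    mul_pow, Real.norm_eq_abs, sq_abs]
  ring_nf

lemma girsanov_gridSum {T h : ℝ≥0} (hT : n * h = T) (v : Fin q → Fin n → ℝ) (θ : E q) :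
    girsanov T (gridSum v) θ = ∏ j, ∏ i, Real.exp (-(θ j * v j i) - θ j ^ 2 * h / 2) := by
  have hT' : (T : ℝ) = n * h := by exact_mod_cast hT.symm
  simp only [← Real.exp_sum, girsanov, EuclideanSpace.norm_sq_eq, PiLp.inner_apply, gridSum,
    Finset.sum_sub_distrib, Finset.sum_neg_distrib, Finset.sum_const, Finset.card_univ,
    Fintype.card_fin, hT', Real.norm_eq_abs, sq_abs, RCLike.inner_apply, conj_trivial,
    Finset.sum_mul, Finset.sum_div, nsmul_eq_mul]
  congr 2
  · congr 1
    exact Finset.sum_congr rfl fun j _ => Finset.sum_congr rfl fun i _ => mul_comm _ _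
  · exact Finset.sum_congr rfl fun j _ => by ring

lemma gridMeasure_withDensity_girsanov {T h : ℝ≥0} (hh : h ≠ 0) (hT : n * h = T) (θ : E q) :
    (gridMeasure q n h).withDensity (fun v => ENNReal.ofReal (girsanov T (gridSum v) θ)) =
      Measure.pi fun j => Measure.pi fun _ => gaussianReal (-(h * θ j)) h := by
  have hdensity (v : Fin q → Fin n → ℝ) : ENNReal.ofReal (girsanov T (gridSum v) θ) =
      ∏ j, ∏ i, ENNReal.ofReal (Real.exp (-(θ j * v j i) - θ j ^ 2 * h / 2)) := by
    rw [girsanov_gridSum hT, ENNReal.ofReal_prod_of_nonneg fun _ _ =>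
      Finset.prod_nonneg fun _ _ => (Real.exp_pos _).le]
    exact Finset.prod_congr rfl fun j _ =>
      ENNReal.ofReal_prod_of_nonneg fun _ _ => (Real.exp_pos _).le
  have hrow (j : Fin q) : (Measure.pi fun _ : Fin n => gaussianReal 0 h).withDensity
      (fun u => ∏ i, ENNReal.ofReal (Real.exp (-(θ j * u i) - θ j ^ 2 * h / 2))) =
      Measure.pi fun _ => gaussianReal (-(h * θ j)) h :=
    pi_withDensity_prod (f := fun _ y => ENNReal.ofReal (Real.exp (-(θ j * y) - θ j ^ 2 * h / 2)))
      (fun _ => by fun_prop) fun _ => gaussianReal_withDensity_exp hh (θ j)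
  simp only [hdensity, gridMeasure]
  exact pi_withDensity_prod (μ := fun _ => Measure.pi fun _ => gaussianReal 0 h)
    (f := fun j u => ∏ i, ENNReal.ofReal (Real.exp (-(θ j * u i) - θ j ^ 2 * h / 2)))
    (fun j => by fun_prop) hrow

lemma measurePreserving_gridShift {T h : ℝ≥0} (hh : h ≠ 0) (hT : n * h = T) (θ : E q) :
    MeasurePreserving (gridShift h θ)
      ((gridMeasure q n h).withDensity fun v => ENNReal.ofReal (girsanov T (gridSum v) θ))
      (gridMeasure q n h) := by
  rw [gridMeasure_withDensity_girsanov hh hT]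
  have hcoord (j : Fin q) : MeasurePreserving (fun y => y + h * θ j)
      (gaussianReal (-(h * θ j)) h) (gaussianReal 0 h) :=
    ⟨by fun_prop, by rw [gaussianReal_map_add_const, neg_add_cancel]⟩
  exact measurePreserving_pi _ _ fun j => measurePreserving_pi _ _ fun _ => hcoord j

lemma lintegral_gridShift_mul_girsanov {T h : ℝ≥0} (hh : h ≠ 0) (hT : n * h = T) (θ : E q)
    {F : (Fin q → Fin n → ℝ) → ℝ≥0∞} (hF : Measurable F) :
    ∫⁻ v, F (gridShift h θ v) * ENNReal.ofReal (girsanov T (gridSum v) θ) ∂gridMeasure q n h =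
      ∫⁻ v, F v ∂gridMeasure q n h := by
  have hshift := measurePreserving_gridShift hh hT θ
  have hFshift : Measurable fun v => F (gridShift h θ v) := hF.comp hshift.measurable
  rw [← hshift.lintegral_comp hF, lintegral_withDensity_eq_lintegral_mul _ (by fun_prop) hFshift]
  exact lintegral_congr fun v => mul_comm _ _

lemma integral_gridShift_mul_girsanov {T h : ℝ≥0} (hh : h ≠ 0) (hT : n * h = T) (θ : E q)
    {F : (Fin q → Fin n → ℝ) → ℝ} (hF : Measurable F) :
    ∫ v, F (gridShift h θ v) * girsanov T (gridSum v) θ ∂gridMeasure q n h =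
      ∫ v, F v ∂gridMeasure q n h := by
  have hshift := measurePreserving_gridShift hh hT θ
  have hFshift : ∫ v, F (gridShift h θ v) ∂((gridMeasure q n h).withDensity fun v =>
      ENNReal.ofReal (girsanov T (gridSum v) θ)) = ∫ v, F v ∂gridMeasure q n h := by
    rw [← integral_map hshift.aemeasurable hF.aestronglyMeasurable, hshift.map_eq]
  rw [← hFshift, integral_withDensity_eq_integral_toReal_smul (by fun_prop)
      (.of_forall fun _ => ENNReal.ofReal_lt_top)]
  simp only [ENNReal.toReal_ofReal (girsanov_pos _ _ _).le, smul_eq_mul, mul_comm]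

lemma lintegral_girsanov_rpow {T h : ℝ≥0} (hh : h ≠ 0) (hT : n * h = T) (θ : E q) (a : ℝ) :
    ∫⁻ v, ENNReal.ofReal (girsanov T (gridSum v) θ ^ a) ∂gridMeasure q n h =
      ENNReal.ofReal (Real.exp ((a ^ 2 - a) * ‖θ‖ ^ 2 * T / 2)) := by
  have hone : ∫⁻ v, ENNReal.ofReal (girsanov T (gridSum v) (a • θ)) ∂gridMeasure q n h = 1 := by
    simpa using lintegral_gridShift_mul_girsanov hh hT (a • θ) (F := fun _ => 1) measurable_const
  simp only [girsanov_rpow, ENNReal.ofReal_mul (Real.exp_pos _).le]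
  rw [lintegral_const_mul' _ _ ENNReal.ofReal_ne_top, hone, mul_one]

lemma mul_rpow_le_rpow_mul_add_rpow {x y s p : ℝ} (hx : 0 ≤ x) (hy : 0 < y) (hs : 0 < s)
    (hsp : s < p) : (x * y) ^ s ≤ x ^ p * y + y ^ (s * (p - 1) / (p - s)) := by
  have hps : 0 < p - s := sub_pos.2 hsp
  rw [Real.mul_rpow hx hy.le]
  rcases le_total (y ^ (s - 1)) (x ^ (p - s)) with hle | hle
  · have hbound : x ^ s * y ^ s ≤ x ^ p * y :=
      calc x ^ s * y ^ s = x ^ s * y ^ (s - 1) * y := by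
            rw [mul_assoc, ← Real.rpow_add_one hy.ne', sub_add_cancel]
        _ ≤ x ^ s * x ^ (p - s) * y := by gcongr
        _ = x ^ p * y := by
            rw [← Real.rpow_add_of_nonneg hx hs.le hps.le, add_sub_cancel]
    exact hbound.trans (le_add_of_nonneg_right (by positivity))
  · have hxy : x ^ s ≤ y ^ ((s - 1) * (s / (p - s))) :=
      calc x ^ s = (x ^ (p - s)) ^ (s / (p - s)) := by
            rw [← Real.rpow_mul hx, mul_div_cancel₀ _ hps.ne']
        _ ≤ (y ^ (s - 1)) ^ (s / (p - s)) := by gcongr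
        _ = _ := (Real.rpow_mul hy.le _ _).symm
    have hbound : x ^ s * y ^ s ≤ y ^ (s * (p - 1) / (p - s)) :=
      calc x ^ s * y ^ s ≤ y ^ ((s - 1) * (s / (p - s))) * y ^ s := by gcongr
        _ = y ^ (s * (p - 1) / (p - s)) := by
            rw [← Real.rpow_add hy]
            congr 1
            field_simp
            ring
    exact hbound.trans (le_add_of_nonneg_left (by positivity))

lemma lintegral_enorm_gridShift_mul_girsanov_rpow_le {T h : ℝ≥0} (hh : h ≠ 0) (hT : n * h = T)
    (θ : E q) {F : (Fin q → Fin n → ℝ) → ℝ} (hF : Measurable F) {s p a : ℝ} (hs : 0 < s)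
    (hsp : s < p) (ha : a = s * (p - 1) / (p - s)) :
    ∫⁻ v, ‖F (gridShift h θ v) * girsanov T (gridSum v) θ‖ₑ ^ s ∂gridMeasure q n h ≤
      ∫⁻ v, ‖F v‖ₑ ^ p ∂gridMeasure q n h +
        ENNReal.ofReal (Real.exp ((a ^ 2 - a) * ‖θ‖ ^ 2 * T / 2)) := by
  have hpointwise (v : Fin q → Fin n → ℝ) :
      ‖F (gridShift h θ v) * girsanov T (gridSum v) θ‖ₑ ^ s ≤
        ‖F (gridShift h θ v)‖ₑ ^ p * ENNReal.ofReal (girsanov T (gridSum v) θ) +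
          ENNReal.ofReal (girsanov T (gridSum v) θ ^ a) := by
    have hg := girsanov_pos T (gridSum v) θ
    rw [← ofReal_norm, ← ofReal_norm, norm_mul, Real.norm_of_nonneg hg.le,
      ENNReal.ofReal_rpow_of_nonneg (by positivity) hs.le,
      ENNReal.ofReal_rpow_of_nonneg (by positivity) (hs.trans hsp).le,
      ← ENNReal.ofReal_mul (by positivity), ← ENNReal.ofReal_add (by positivity) (by positivity),
      ha]
    exact ENNReal.ofReal_le_ofReal (mul_rpow_le_rpow_mul_add_rpow (norm_nonneg _) hg hs hsp)
  refine (lintegral_mono hpointwise).trans_eq ?_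
  rw [lintegral_add_right _ (by fun_prop), lintegral_girsanov_rpow hh hT,
    lintegral_gridShift_mul_girsanov hh hT θ (F := fun v => ‖F v‖ₑ ^ p) (by fun_prop)]

end Girsanov

/-! ### Schemes as functions of the increments on a grid -/

section Grid

variable {d q n : ℕ}

lemma schemePath_congr (Ψ : ℝ → E d → E q → E d) (h : ℝ≥0) (x : E d) {w w' : ℝ≥0 → E q}
    {θ θ' : E q} {k : ℕ}
    (hw : ∀ i < k, w ((i + 1) * h) - w (i * h) + (h : ℝ) • θ =
      w' ((i + 1) * h) - w' (i * h) + (h : ℝ) • θ') :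
    schemePath Ψ h x w θ k = schemePath Ψ h x w' θ' k := by
  induction k with
  | zero => rfl
  | succ k ih =>
    rw [schemePath, schemePath, ih fun i hi => hw i (hi.trans k.lt_succ_self),
      hw k k.lt_succ_self]

/-- The path that starts at `0` and jumps by the increments `v` at the grid points of mesh `h`. -/
def gridPath (h : ℝ≥0) (v : Fin q → Fin n → ℝ) (t : ℝ≥0) : E q :=
  WithLp.toLp 2 fun j => ∑ i : Fin n, if (i + 1) * h ≤ t then v j i else 0

/-- The first `n` increments of the path `w` on the grid of mesh `h`. -/
def gridIncr (n : ℕ) (h : ℝ≥0) (w : ℝ≥0 → E q) : Fin q → Fin n → ℝ :=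
  fun j i => w ((i + 1) * h) j - w (i * h) j

lemma sum_fin_ite_succ_le {A : Type*} [AddCommMonoid A] {k : ℕ} (hk : k ≤ n) (f : ℕ → A) :
    ∑ i : Fin n, (if (i : ℕ) + 1 ≤ k then f i else 0) = ∑ i ∈ Finset.range k, f i := by
  rw [Fin.sum_univ_eq_sum_range (fun i => if i + 1 ≤ k then f i else 0), ← Finset.sum_filter]
  congr 1
  ext i
  simp only [Finset.mem_filter, Finset.mem_range]
  lia

lemma gridPath_apply {h : ℝ≥0} (hh : 0 < h) (v : Fin q → Fin n → ℝ) (k : ℕ) (j : Fin q) :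
    gridPath h v (k * h) j = ∑ i : Fin n, if (i : ℕ) + 1 ≤ k then v j i else 0 := by
  have hle (i : Fin n) : ((i : ℕ) + 1 : ℝ≥0) * h ≤ k * h ↔ (i : ℕ) + 1 ≤ k := by
    rw [mul_le_mul_iff_left₀ hh]
    exact_mod_cast Iff.rfl
  simp only [gridPath, hle]

lemma gridPath_gridShift_gridIncr {h : ℝ≥0} (hh : 0 < h) (w : ℝ≥0 → E q) (θ : E q) {k : ℕ}
    (hk : k ≤ n) :
    gridPath h (gridShift h θ (gridIncr n h w)) (k * h) =
      w (k * h) - w 0 + ((k : ℝ) * h) • θ := by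
  ext j
  have htelescope := Finset.sum_range_sub (fun i : ℕ => w (i * h) j) k
  push_cast at htelescope
  simp only [gridPath_apply hh, gridShift, gridIncr]
  rw [sum_fin_ite_succ_le hk (fun i => w ((i + 1) * h) j - w (i * h) j + h * θ j),
    Finset.sum_add_distrib, htelescope]
  simp only [zero_mul, Finset.sum_const, Finset.card_range, nsmul_eq_mul, PiLp.add_apply,
    PiLp.sub_apply, PiLp.smul_apply, smul_eq_mul, mul_assoc]

lemma gridSum_gridIncr (n : ℕ) (h : ℝ≥0) (w : ℝ≥0 → E q) :
    gridSum (gridIncr n h w) = w (n * h) - w 0 := by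
  ext j
  have htelescope := Finset.sum_range_sub (fun i : ℕ => w (i * h) j) n
  push_cast at htelescope
  simp only [gridSum, gridIncr]
  rw [Fin.sum_univ_eq_sum_range (fun i => w ((i + 1) * h) j - w (i * h) j) n, htelescope,
    zero_mul, PiLp.sub_apply]

lemma schemeEnd_eq_gridPath (Ψ : ℝ → E d → E q → E d) {T : ℝ≥0} (hT : 0 < T) (x : E d)
    {k : ℕ} (hk : k ∣ n) (hn : 0 < n) (w : ℝ≥0 → E q) (θ : E q) :
    schemeEnd Ψ T x k w θ =
      schemeEnd Ψ T x k (gridPath (T / n) (gridShift (T / n) θ (gridIncr n (T / n) w))) 0 := by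
  obtain ⟨c, rfl⟩ := hk
  set h : ℝ≥0 := T / (k * c : ℕ) with hdef
  have hh : 0 < h := div_pos hT (by exact_mod_cast hn)
  have hstep : T / k = c * h := by
    have hc : (c : ℝ≥0) ≠ 0 := by exact_mod_cast (Nat.pos_of_mul_pos_left hn).ne'
    rw [hdef, Nat.cast_mul, ← div_div, mul_div_cancel₀ _ hc]
  refine schemePath_congr Ψ _ x fun i hi => ?_
  have hnode (i : ℕ) : (i : ℝ≥0) * (T / k) = (i * c : ℕ) * h := by
    rw [hstep, Nat.cast_mul, mul_assoc]
  have hnode_succ : ((i : ℝ≥0) + 1) * (T / k) = ((i + 1) * c : ℕ) * h := by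
    exact_mod_cast hnode (i + 1)
  rw [hnode, hnode_succ, gridPath_gridShift_gridIncr hh w θ (Nat.mul_le_mul_right c hi),
    gridPath_gridShift_gridIncr hh w θ (Nat.mul_le_mul_right c hi.le), hstep]
  push_cast
  module

lemma measurable_gridPath (h t : ℝ≥0) :
    Measurable fun v : Fin q → Fin n → ℝ => gridPath h v t := by
  refine (WithLp.measurable_toLp 2 _).comp (measurable_pi_lambda _ fun j =>
    Finset.measurable_fun_sum _ fun i _ => ?_)
  split_ifs <;> fun_prop

end Grid

/-! ### The level terms -/

section LevelTerm

variable {d q : ℕ} {X : Type*} [MeasurableSpace X] {r : Params} {Ψ : ℝ → E d → E q → E d}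
  {x : E d} {P : E d → ℝ}

/-- The factor of `levelTerm` other than the Girsanov density. -/
def levelPayoff (r : Params) (Ψ : ℝ → E d → E q → E d) (x : E d) (P : E d → ℝ)
    (l : ℕ) (w : ℝ≥0 → E q) (θ : E q) : ℝ :=
  levelDiff (fun l => P (schemeEnd Ψ r.T x (r.steps l) w θ)) l

lemma levelTerm_eq_levelPayoff_mul (l : ℕ) (w : ℝ≥0 → E q) (θ : E q) :
    levelTerm r Ψ x P l w θ = levelPayoff r Ψ x P l w θ * girsanov r.T (w r.T) θ := by
  cases l <;> rfl

/-- The mesh of the grid of level `l`. -/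
def Params.mesh (r : Params) (l : ℕ) : ℝ≥0 := r.T / r.steps l

lemma Params.steps_pos (hM : 0 < r.M) (hm : 1 ≤ r.m) (l : ℕ) : 0 < r.steps l :=
  Nat.mul_pos hm (Nat.pow_pos hM)

lemma Params.mesh_pos (hT : 0 < r.T) (hM : 0 < r.M) (hm : 1 ≤ r.m) (l : ℕ) : 0 < r.mesh l :=
  div_pos hT (by exact_mod_cast Params.steps_pos hM hm l)

lemma Params.steps_mul_mesh (hM : 0 < r.M) (hm : 1 ≤ r.m) (l : ℕ) :
    r.steps l * r.mesh l = r.T :=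
  mul_div_cancel₀ _ (by exact_mod_cast (Params.steps_pos hM hm l).ne')

/-- `levelPayoff` as a function of the increments of the driving path on the grid of level `l`. -/
def gridPayoff (r : Params) (Ψ : ℝ → E d → E q → E d) (x : E d) (P : E d → ℝ) (l : ℕ)
    (v : Fin q → Fin (r.steps l) → ℝ) : ℝ :=
  levelPayoff r Ψ x P l (gridPath (r.mesh l) v) 0

lemma levelPayoff_eq_gridPayoff (hT : 0 < r.T) (hM : 0 < r.M) (hm : 1 ≤ r.m) (l : ℕ)
    (w : ℝ≥0 → E q) (θ : E q) :
    levelPayoff r Ψ x P l w θ = gridPayoff r Ψ x P l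
      (gridShift (r.mesh l) θ (gridIncr (r.steps l) (r.mesh l) w)) := by
  have hcoarse {i : ℕ} (hi : i ≤ l) := schemeEnd_eq_gridPath Ψ hT x
    (Nat.mul_dvd_mul_left r.m (pow_dvd_pow r.M hi)) (Params.steps_pos hM hm l) w θ
  cases l with
  | zero => exact congrArg P (hcoarse le_rfl)
  | succ l => exact congrArg₂ (fun y z => P y - P z) (hcoarse le_rfl) (hcoarse l.le_succ)

lemma gridPayoff_gridIncr (hT : 0 < r.T) (hM : 0 < r.M) (hm : 1 ≤ r.m) (l : ℕ)
    {Ω : Type*} (B : ℝ≥0 → Ω → E q) (ω : Ω) :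
    gridPayoff r Ψ x P l (gridIncr (r.steps l) (r.mesh l) fun t => B t ω) =
      levelDiff (fun l => approxPayoff r Ψ x P B (r.M ^ l) ω) l := by
  have hshift (v : Fin q → Fin (r.steps l) → ℝ) : gridShift (r.mesh l) 0 v = v := by
    ext
    simp [gridShift]
  have hpayoff :=
    levelPayoff_eq_gridPayoff (Ψ := Ψ) (x := x) (P := P) hT hM hm l (fun t => B t ω) 0
  rw [hshift] at hpayoff
  exact hpayoff.symm

/-- `levelTerm` as a function of the parameter and of the increments on the grid of level `l`. -/
def gridTerm (r : Params) (Ψ : ℝ → E d → E q → E d) (x : E d) (P : E d → ℝ) (l : ℕ)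
    (θ : E q) (v : Fin q → Fin (r.steps l) → ℝ) : ℝ :=
  gridPayoff r Ψ x P l (gridShift (r.mesh l) θ v) * girsanov r.T (gridSum v) θ

lemma levelTerm_eq_gridTerm (hT : 0 < r.T) (hM : 0 < r.M) (hm : 1 ≤ r.m) (l : ℕ)
    {w : ℝ≥0 → E q} (hw : w 0 = 0) (θ : E q) :
    levelTerm r Ψ x P l w θ = gridTerm r Ψ x P l θ (gridIncr (r.steps l) (r.mesh l) w) := by
  rw [gridTerm, ← levelPayoff_eq_gridPayoff hT hM hm, gridSum_gridIncr,
    Params.steps_mul_mesh hM hm, hw, sub_zero, levelTerm_eq_levelPayoff_mul]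

lemma measurable_schemePath {h : ℝ≥0} (hΨ : Measurable (Function.uncurry (Ψ h)))
    {w : ℝ≥0 → X → E q} {θ : X → E q} (hθ : Measurable θ) {k : ℕ}
    (hw : ∀ i ≤ k, Measurable (w (i * h))) :
    Measurable fun ω => schemePath Ψ h x (fun t => w t ω) (θ ω) k := by
  induction k with
  | zero => exact measurable_const
  | succ k ih =>
    have hleft := hw k k.le_succ
    have hright := hw (k + 1) le_rfl
    push_cast at hright
    exact hΨ.comp ((ih fun i hi => hw i (hi.trans k.le_succ)).prodMk
      ((hright.sub hleft).add (hθ.const_smul (h : ℝ))))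

lemma measurable_schemeEnd (hΨ : ∀ h : ℝ, Measurable (Function.uncurry (Ψ h))) (T : ℝ≥0)
    {w : ℝ≥0 → X → E q} {θ : X → E q} (hθ : Measurable θ) (k : ℕ)
    (hw : ∀ t ≤ T, Measurable (w t)) :
    Measurable fun ω => schemeEnd Ψ T x k (fun t => w t ω) (θ ω) := by
  refine measurable_schemePath (hΨ _) hθ fun i hi => hw _ ?_
  calc (i : ℝ≥0) * (T / k) ≤ k * (T / k) := by gcongr
    _ = T * (k / k) := mul_div_left_comm _ _ _
    _ ≤ T := mul_le_of_le_one_right' (div_self_le_one _)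

lemma measurable_levelPayoff (hΨ : ∀ h : ℝ, Measurable (Function.uncurry (Ψ h)))
    (hP : Measurable P) {w : ℝ≥0 → X → E q} {θ : X → E q} (hθ : Measurable θ) (l : ℕ)
    (hw : ∀ t ≤ r.T, Measurable (w t)) :
    Measurable fun ω => levelPayoff r Ψ x P l (fun t => w t ω) (θ ω) := by
  have hscheme (k : ℕ) := hP.comp (measurable_schemeEnd (x := x) hΨ r.T hθ k hw)
  cases l with
  | zero => exact hscheme _
  | succ l => exact (hscheme _).sub (hscheme _)

lemma measurable_levelTerm (hΨ : ∀ h : ℝ, Measurable (Function.uncurry (Ψ h)))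
    (hP : Measurable P) {w : ℝ≥0 → X → E q} {θ : X → E q} (hθ : Measurable θ) (l : ℕ)
    (hw : ∀ t ≤ r.T, Measurable (w t)) :
    Measurable fun ω => levelTerm r Ψ x P l (fun t => w t ω) (θ ω) := by
  simp only [levelTerm_eq_levelPayoff_mul]
  exact (measurable_levelPayoff hΨ hP hθ l hw).mul (measurable_girsanov r.T (hw _ le_rfl) hθ)

lemma measurable_gridPayoff (hΨ : ∀ h : ℝ, Measurable (Function.uncurry (Ψ h)))
    (hP : Measurable P) (l : ℕ) : Measurable (gridPayoff r Ψ x P l) :=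
  measurable_levelPayoff hΨ hP measurable_const l fun t _ => measurable_gridPath _ t

lemma measurable_gridTerm (hΨ : ∀ h : ℝ, Measurable (Function.uncurry (Ψ h)))
    (hP : Measurable P) (l : ℕ) :
    Measurable fun z : E q × (Fin q → Fin (r.steps l) → ℝ) => gridTerm r Ψ x P l z.1 z.2 := by
  have hpayoff := (measurable_gridPayoff (r := r) (x := x) hΨ hP l).comp
    (measurable_gridShift (r.mesh l))
  have hdensity := measurable_girsanov r.T (f := fun z : E q × (Fin q → Fin (r.steps l) → ℝ) =>
    gridSum z.2) (measurable_gridSum.comp measurable_snd) measurable_fst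
  exact hpayoff.mul hdensity

end LevelTerm

/-! ### Increments of Brownian motion and their σ-algebras -/

section BrownianIncrements

variable {Ω : Type*} {q : ℕ} {T : ℝ≥0}

lemma measurable_gridIncr [MeasurableSpace Ω] {n : ℕ} {h : ℝ≥0} (hT : n * h ≤ T)
    {W : ℝ≥0 → Ω → E q} (hW : ∀ t ≤ T, Measurable (W t)) :
    Measurable fun ω => gridIncr n h (fun t => W t ω) := by
  have hnode {k : ℕ} (hk : k ≤ n) : Measurable (W (k * h)) := hW _ (le_trans (by gcongr) hT)
  refine measurable_pi_lambda _ fun j => measurable_pi_lambda _ fun i => ?_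
  have hright := hnode (k := i + 1) i.2
  have hleft := hnode i.2.le
  push_cast at hright
  have happly : Measurable fun y : E q => y j := by fun_prop
  exact (happly.comp hright).sub (happly.comp hleft)

lemma measurable_pathSigma (W : ℝ≥0 → Ω → E q) {t : ℝ≥0} (ht : t ≤ T) :
    Measurable[pathSigma T W] (W t) :=
  Measurable.mono (comap_measurable (W t)) (le_iSup₂_of_le t ht le_rfl) le_rfl

lemma pathSigma_le_pastSigma (W : ℕ → ℕ → ℝ≥0 → Ω → E q) (l : ℕ) {j k : ℕ} (hjk : j < k) :
    pathSigma T (W l j) ≤ pastSigma T W k :=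
  le_iSup_of_le l (le_iSup₂_of_le j hjk le_rfl)

lemma pastSigma_mono (W : ℕ → ℕ → ℝ≥0 → Ω → E q) : Monotone (pastSigma T W) := fun _ _ hab =>
  iSup_le fun l => iSup₂_le fun _ hj => pathSigma_le_pastSigma W l (hj.trans_le hab)

variable [mΩ : MeasurableSpace Ω] {μ : Measure Ω}

lemma pathSigma_le {W : ℝ≥0 → Ω → E q} (hW : ∀ t, Measurable (W t)) : pathSigma T W ≤ mΩ :=
  iSup₂_le fun t _ => (hW t).comap_le

/-- The filtration generated by the successive sample paths of all levels, up to time `T`. -/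
def pastFiltration (T : ℝ≥0) (W : ℕ → ℕ → ℝ≥0 → Ω → E q)
    (hW : ∀ l k t, Measurable (W l k t)) : Filtration ℕ mΩ where
  seq := pastSigma T W
  mono' := pastSigma_mono W
  le' _ := iSup_le fun l => iSup₂_le fun j _ => pathSigma_le (hW l j)

lemma indep_pastSigma {W : ℕ → ℕ → ℝ≥0 → Ω → E q} (hW : ∀ l k t, Measurable (W l k t))
    (hWindep : iIndep (fun i : ℕ × ℕ => pathSigma T (W i.1 i.2)) μ) (l k : ℕ) :
    Indep (pastSigma T W k) (pathSigma T (W l k)) μ := by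
  have hindep := indep_iSup_of_disjoint (fun i : ℕ × ℕ => pathSigma_le (T := T) (hW i.1 i.2))
    hWindep (S := {i : ℕ × ℕ | i.2 < k}) (T := {(l, k)}) (by simp)
  rw [iSup_singleton] at hindep
  exact indep_of_indep_of_le_left hindep <| iSup_le fun l' => iSup₂_le fun j hj =>
    le_iSup₂_of_le (f := fun (i : ℕ × ℕ) (_ : i ∈ {i : ℕ × ℕ | i.2 < k}) =>
      pathSigma T (W i.1 i.2)) (l', j) hj le_rfl

lemma IsBrownianMotion.ae_zero {W : ℝ≥0 → Ω → E q} (hW : IsBrownianMotion W μ) :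
    ∀ᵐ ω ∂μ, W 0 ω = 0 := by
  filter_upwards [ae_all_iff.2 fun j => (hW.coord j).eval_zero_ae_eq_zero] with ω hω
  ext j
  exact hω j

lemma IsBrownianMotion.map_gridIncr {W : ℝ≥0 → Ω → E q} (hW : IsBrownianMotion W μ)
    (n : ℕ) (h : ℝ≥0) :
    μ.map (fun ω => gridIncr n h (fun t => W t ω)) = gridMeasure q n h := by
  have hincr (j : Fin q) (i : Fin n) :
      HasLaw (fun ω => W ((i + 1) * h) ω j - W (i * h) ω j) (gaussianReal 0 h) μ := by
    have hlaw : HasLaw (fun ω => W ((i + 1) * h) ω j - W (i * h) ω j)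
        (gaussianReal 0 (nndist (((i + 1) * h : ℝ≥0) : ℝ) ((i * h : ℝ≥0) : ℝ))) μ :=
      (hW.coord j).hasLaw_sub ((i + 1) * h) (i * h)
    have hdist : nndist (((i + 1) * h : ℝ≥0) : ℝ) ((i * h : ℝ≥0) : ℝ) = h := by
      ext
      rw [coe_nndist, Real.dist_eq]
      push_cast
      rw [add_one_mul, add_sub_cancel_left, NNReal.abs_eq]
    rwa [hdist] at hlaw
  have hcoord (j : Fin q) :
      HasLaw (fun ω (i : Fin n) => W ((i + 1) * h) ω j - W (i * h) ω j)
        (Measure.pi fun _ : Fin n => gaussianReal 0 h) μ := by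
    have hmono : Monotone fun i : ℕ => (i : ℝ≥0) * h := fun a b hab => by dsimp only; gcongr
    have hindep := ((hW.coord j).hasIndepIncrements.nat hmono).precomp (Fin.val_injective (n := n))
    push_cast at hindep
    exact hindep.hasLaw_pi (hincr j)
  have hindep : iIndepFun (fun (j : Fin q) ω (i : Fin n) =>
      W ((i + 1) * h) ω j - W (i * h) ω j) μ :=
    hW.indep.comp (fun (_ : Fin q) (f : ℝ≥0 → ℝ) (i : Fin n) =>
      f ((i + 1) * h) - f (i * h)) fun j => by fun_prop
  exact (hindep.hasLaw_pi hcoord).map_eq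

end BrownianIncrements

/-! ### Averaging over an independent variable -/

section Freezing

variable {Ω α V : Type*} {m mΩ : MeasurableSpace Ω} {μ : Measure Ω}
  [IsFiniteMeasure μ] [MeasurableSpace α] [MeasurableSpace V] {Y : Ω → α} {H : Ω → V}

lemma lintegral_comp_prodMk_of_indepFun (hY : Measurable Y) (hH : Measurable H)
    (hind : IndepFun Y H μ) {F : α × V → ℝ≥0∞} (hF : Measurable F) :
    ∫⁻ ω, F (Y ω, H ω) ∂μ = ∫⁻ ω, ∫⁻ v, F (Y ω, v) ∂(μ.map H) ∂μ := by
  rw [← lintegral_map hF (hY.prodMk hH),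
    (indepFun_iff_map_prod_eq_prod_map_map hY.aemeasurable hH.aemeasurable).1 hind,
    lintegral_prod _ hF.aemeasurable, lintegral_map hF.lintegral_prod_right' hY]

lemma integrable_prod_map_of_indepFun (hY : Measurable Y) (hH : Measurable H)
    (hind : IndepFun Y H μ) {F : α × V → ℝ} (hF : Measurable F)
    (hi : Integrable (fun ω => F (Y ω, H ω)) μ) : Integrable F ((μ.map Y).prod (μ.map H)) := by
  rwa [← (indepFun_iff_map_prod_eq_prod_map_map hY.aemeasurable hH.aemeasurable).1 hind,
    integrable_map_measure hF.aestronglyMeasurable (hY.prodMk hH).aemeasurable]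

lemma integral_comp_prodMk_of_indepFun (hY : Measurable Y) (hH : Measurable H)
    (hind : IndepFun Y H μ) {F : α × V → ℝ} (hF : Measurable F)
    (hi : Integrable (fun ω => F (Y ω, H ω)) μ) :
    ∫ ω, F (Y ω, H ω) ∂μ = ∫ ω, ∫ v, F (Y ω, v) ∂(μ.map H) ∂μ := by
  rw [← integral_map (hY.prodMk hH).aemeasurable hF.aestronglyMeasurable,
    (indepFun_iff_map_prod_eq_prod_map_map hY.aemeasurable hH.aemeasurable).1 hind,
    integral_prod _ (integrable_prod_map_of_indepFun hY hH hind hF hi),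
    integral_map hY.aemeasurable
      hF.stronglyMeasurable.integral_prod_right'.aestronglyMeasurable]

lemma condExp_comp_prodMk_of_indep (hm : m ≤ mΩ) (hY : Measurable[m] Y) (hH : Measurable H)
    (hind : Indep m (MeasurableSpace.comap H inferInstance) μ) {F : α × V → ℝ}
    (hF : Measurable F) (hi : Integrable (fun ω => F (Y ω, H ω)) μ) :
    μ[fun ω => F (Y ω, H ω) | m] =ᵐ[μ] fun ω => ∫ v, F (Y ω, v) ∂(μ.map H) := by
  have hYΩ : Measurable Y := hY.mono hm le_rfl
  have hmean : StronglyMeasurable fun y => ∫ v, F (y, v) ∂(μ.map H) :=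
    hF.stronglyMeasurable.integral_prod_right'
  have hmean_int : Integrable (fun ω => ∫ v, F (Y ω, v) ∂(μ.map H)) μ :=
    (integrable_prod_map_of_indepFun hYΩ hH
      (indep_of_indep_of_le_left hind hY.comap_le) hF hi).integral_prod_left.comp_measurable hYΩ
  refine (ae_eq_condExp_of_forall_setIntegral_eq hm hi (fun _ _ _ => hmean_int.integrableOn)
    (fun s hs _ => ?_) (hmean.comp_measurable hY).aestronglyMeasurable).symm
  -- Freeze the indicator of `s` together with `Y`.
  have hχY : Measurable[m] fun ω => (s.indicator (1 : Ω → ℝ) ω, Y ω) :=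
    (Measurable.indicator measurable_const hs).prodMk hY
  have hmul (f : Ω → ℝ) : (fun ω => s.indicator (1 : Ω → ℝ) ω * f ω) = s.indicator f :=
    funext fun ω => by by_cases h : ω ∈ s <;> simp [h]
  have hfreeze := integral_comp_prodMk_of_indepFun (hχY.mono hm le_rfl) hH
    (indep_of_indep_of_le_left hind hχY.comap_le) (F := fun z => z.1.1 * F (z.1.2, z.2))
    (by fun_prop) (by simpa only [hmul] using hi.indicator (hm s hs))
  simp only [integral_const_mul] at hfreeze
  rw [hmul, hmul, integral_indicator (hm s hs), integral_indicator (hm s hs)] at hfreeze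
  exact hfreeze.symm

end Freezing

/-! ### Moments of the payoffs -/

section Moments

variable {Ω : Type*} [mΩ : MeasurableSpace Ω] {μ : Measure Ω}

lemma eLpNorm_ofReal_eq_lintegral {p : ℝ} (hp : 0 < p) (f : Ω → ℝ) :
    eLpNorm f (ENNReal.ofReal p) μ = (∫⁻ ω, ‖f ω‖ₑ ^ p ∂μ) ^ p⁻¹ := by
  rw [eLpNorm_eq_lintegral_rpow_enorm_toReal (by simpa using hp) ENNReal.ofReal_ne_top,
    ENNReal.toReal_ofReal hp.le, one_div]

lemma lintegral_enorm_rpow_le_of_eLpNorm_le {p : ℝ} {C : ℝ≥0∞} (hp : 0 < p) {f : Ω → ℝ}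
    (h : eLpNorm f (ENNReal.ofReal p) μ ≤ C) : ∫⁻ ω, ‖f ω‖ₑ ^ p ∂μ ≤ C ^ p := by
  rwa [eLpNorm_ofReal_eq_lintegral hp, ENNReal.rpow_inv_le_iff hp] at h

lemma eLpNorm_le_of_lintegral_enorm_rpow_le {p : ℝ} {C : ℝ≥0∞} (hp : 0 < p) {f : Ω → ℝ}
    (h : ∫⁻ ω, ‖f ω‖ₑ ^ p ∂μ ≤ C) : eLpNorm f (ENNReal.ofReal p) μ ≤ C ^ p⁻¹ := by
  rw [eLpNorm_ofReal_eq_lintegral hp]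
  gcongr

lemma integral_abs_rpow_le_of_eLpNorm_le {p : ℝ} {C : ℝ≥0} (hp : 0 < p) {f : Ω → ℝ}
    (hf : AEStronglyMeasurable f μ) (h : eLpNorm f (ENNReal.ofReal p) μ ≤ C) :
    ∫ ω, |f ω| ^ p ∂μ ≤ C ^ p := by
  have hmeas : AEStronglyMeasurable (fun ω => |f ω| ^ p) μ :=
    (hf.norm.aemeasurable.pow_const p).aestronglyMeasurable
  rw [integral_eq_lintegral_of_nonneg_ae (.of_forall fun ω => by positivity) hmeas]
  refine ENNReal.toReal_le_of_le_ofReal (by positivity) ?_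
  convert lintegral_enorm_rpow_le_of_eLpNorm_le hp h using 1
  · refine lintegral_congr fun ω => ?_
    rw [← ENNReal.ofReal_rpow_of_nonneg (abs_nonneg _) hp.le, Real.enorm_eq_ofReal_abs]
  · rw [← ENNReal.ofReal_rpow_of_nonneg C.coe_nonneg hp.le, ENNReal.ofReal_coe_nnreal]

lemma eLpNorm_sub_integral_le [IsProbabilityMeasure μ] {p : ℝ≥0∞} (hp : 1 ≤ p) {f : Ω → ℝ}
    (hf : AEStronglyMeasurable f μ) :
    eLpNorm (fun ω => f ω - ∫ ω', f ω' ∂μ) p μ ≤ 2 * eLpNorm f p μ := by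
  have hmean : ‖∫ ω', f ω' ∂μ‖ₑ ≤ eLpNorm f p μ :=
    (enorm_integral_le_lintegral_enorm f).trans <| by
      rw [← eLpNorm_one_eq_lintegral_enorm]
      exact eLpNorm_le_eLpNorm_of_exponent_le hp hf
  calc eLpNorm (fun ω => f ω - ∫ ω', f ω' ∂μ) p μ
      ≤ eLpNorm f p μ + eLpNorm (fun _ => ∫ ω', f ω' ∂μ) p μ :=
        eLpNorm_sub_le hf aestronglyMeasurable_const hp
    _ ≤ eLpNorm f p μ + eLpNorm f p μ := by
        rw [eLpNorm_const _ (by positivity) (NeZero.ne μ), measure_univ, ENNReal.one_rpow, mul_one]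
        gcongr
    _ = 2 * eLpNorm f p μ := (two_mul _).symm

variable {d q : ℕ} {r : Params} {Ψ : ℝ → E d → E q → E d} {x : E d} {P : E d → ℝ}
  {B : ℝ≥0 → Ω → E q} {p : ℝ}

lemma measurable_approxPayoff (hΨ : ∀ h : ℝ, Measurable (Function.uncurry (Ψ h)))
    (hP : Measurable P) (hB : ∀ t, Measurable (B t)) (n : ℕ) :
    Measurable (approxPayoff r Ψ x P B n) :=
  hP.comp (measurable_schemeEnd hΨ r.T measurable_const _ fun t _ => hB t)

lemma StrongError.exists_eLpNorm_approxPayoff_le (hT : 0 < r.T) (hm : 1 ≤ r.m) (hβ : 0 < r.β)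
    (hp : 1 ≤ p) (hΨ : ∀ h : ℝ, Measurable (Function.uncurry (Ψ h))) (hP : Measurable P)
    (hB : ∀ t, Measurable (B t)) {X : ℝ≥0 → Ω → E d} {V : ℝ} (hV : 0 < V)
    (hX : MemLp (fun ω => P (X r.T ω)) (ENNReal.ofReal p) μ)
    (h : StrongError r Ψ x P B X μ p V) :
    ∃ C : ℝ≥0, ∀ n : ℕ, 1 ≤ n → eLpNorm (approxPayoff r Ψ x P B n) (ENNReal.ofReal p) μ ≤ C := by
  have hp0 : 0 < p := by linarith
  have hh := (Params.hbar_pos hT hm).le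
  set C : ℝ≥0∞ := ENNReal.ofReal (V * r.hbar ^ (r.β * p / 2)) ^ p⁻¹ +
    eLpNorm (fun ω => P (X r.T ω)) (ENNReal.ofReal p) μ
  have hCtop : C ≠ ∞ := ENNReal.add_ne_top.2
    ⟨ENNReal.rpow_ne_top_of_nonneg (by positivity) ENNReal.ofReal_ne_top, hX.eLpNorm_ne_top⟩
  refine ⟨C.toNNReal, fun n hn => ?_⟩
  rw [ENNReal.coe_toNNReal hCtop]
  have herror : eLpNorm (fun ω => approxPayoff r Ψ x P B n ω - P (X r.T ω)) (ENNReal.ofReal p) μ ≤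
      ENNReal.ofReal (V * r.hbar ^ (r.β * p / 2)) ^ p⁻¹ := by
    refine eLpNorm_le_of_lintegral_enorm_rpow_le hp0 ((h n hn).trans ?_)
    gcongr
    exact div_le_self hh (by exact_mod_cast hn)
  have happrox :=
    (measurable_approxPayoff (r := r) (x := x) hΨ hP hB n).aestronglyMeasurable (μ := μ)
  calc eLpNorm (approxPayoff r Ψ x P B n) (ENNReal.ofReal p) μ
      = eLpNorm ((fun ω => approxPayoff r Ψ x P B n ω - P (X r.T ω)) + fun ω => P (X r.T ω))
          (ENNReal.ofReal p) μ := by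
        congr 1
        ext ω
        simp
    _ ≤ C := (eLpNorm_add_le (happrox.sub hX.1) hX.1 (by simpa using hp)).trans
        (add_le_add herror le_rfl)

lemma measurable_gridIncr_mesh (hM : 0 < r.M) (hm : 1 ≤ r.m) (hB : ∀ t ≤ r.T, Measurable (B t))
    (l : ℕ) : Measurable fun ω => gridIncr (r.steps l) (r.mesh l) fun t => B t ω :=
  measurable_gridIncr (Params.steps_mul_mesh hM hm l).le hB

lemma integral_gridPayoff (hT : 0 < r.T) (hM : 0 < r.M) (hm : 1 ≤ r.m)
    (hΨ : ∀ h : ℝ, Measurable (Function.uncurry (Ψ h))) (hP : Measurable P)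
    (hB : IsBrownianMotion B μ)
    (hint : ∀ l : ℕ, Integrable (approxPayoff r Ψ x P B (r.M ^ l)) μ) (l : ℕ) :
    ∫ v, gridPayoff r Ψ x P l v ∂gridMeasure q (r.steps l) (r.mesh l) =
      levelDiff (fun l => ∫ ω, approxPayoff r Ψ x P B (r.M ^ l) ω ∂μ) l := by
  rw [← hB.map_gridIncr, integral_map
    (measurable_gridIncr_mesh hM hm (fun t _ => hB.measurable t) l).aemeasurable
    (measurable_gridPayoff hΨ hP l).aestronglyMeasurable]
  simp only [gridPayoff_gridIncr hT hM hm]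
  cases l with
  | zero => rfl
  | succ l => exact integral_sub (hint _) (hint _)

lemma eLpNorm_gridPayoff_le (hT : 0 < r.T) (hM : 0 < r.M) (hm : 1 ≤ r.m)
    (hΨ : ∀ h : ℝ, Measurable (Function.uncurry (Ψ h))) (hP : Measurable P)
    (hB : IsBrownianMotion B μ) {p C : ℝ≥0∞} (hp : 1 ≤ p)
    (hC : ∀ l : ℕ, eLpNorm (approxPayoff r Ψ x P B (r.M ^ l)) p μ ≤ C) (l : ℕ) :
    eLpNorm (gridPayoff r Ψ x P l) p (gridMeasure q (r.steps l) (r.mesh l)) ≤ C + C := by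
  have happrox (l : ℕ) := (measurable_approxPayoff (r := r) (x := x) hΨ hP hB.measurable
    (r.M ^ l)).aestronglyMeasurable (μ := μ)
  rw [← hB.map_gridIncr, eLpNorm_map_measure (measurable_gridPayoff hΨ hP l).aestronglyMeasurable
    (measurable_gridIncr_mesh hM hm (fun t _ => hB.measurable t) l).aemeasurable]
  simp only [Function.comp_def, gridPayoff_gridIncr hT hM hm]
  cases l with
  | zero => exact (hC 0).trans le_self_add
  | succ l => exact (eLpNorm_sub_le (happrox _) (happrox _) hp).trans (add_le_add (hC _) (hC _))

lemma WeakError.tendsto (hT : 0 < r.T) (hM : 1 < r.M) (hm : 1 ≤ r.m) (hα : 0 < r.α)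
    {X : ℝ≥0 → Ω → E d} (h : WeakError r Ψ x P B X μ) :
    Tendsto (fun l : ℕ => ∫ ω, approxPayoff r Ψ x P B (r.M ^ l) ω ∂μ) atTop
      (𝓝 (∫ ω, P (X r.T ω) ∂μ)) := by
  obtain ⟨c, hc⟩ := h
  obtain ⟨η, hη, hexpansion⟩ := hc 1 le_rfl
  have hpow_pos (l : ℕ) : 0 < r.M ^ l := Nat.pow_pos (by lia)
  have hstep : Tendsto (fun l : ℕ => r.hbar / (r.M ^ l : ℕ)) atTop (𝓝[>] 0) := by
    refine tendsto_nhdsWithin_iff.2 ⟨Tendsto.const_div_atTop (tendsto_natCast_atTop_atTop.comp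
      (tendsto_pow_atTop_atTop_of_one_lt hM)) _, .of_forall fun l => ?_⟩
    exact div_pos (Params.hbar_pos hT hm) (by exact_mod_cast hpow_pos l)
  have hpow : Tendsto (fun l : ℕ => (r.hbar / (r.M ^ l : ℕ)) ^ (r.α * (1 : ℕ))) atTop (𝓝 0) := by
    have hα1 : 0 < r.α * (1 : ℕ) := by simpa using hα
    simpa only [Real.zero_rpow hα1.ne'] using
      (tendsto_nhdsWithin_iff.1 hstep).1.rpow_const (Or.inr hα1.le)
  have hlim := ((hpow.const_mul (c 1)).add (hpow.mul (hη.comp hstep))).add_const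
    (∫ ω, P (X r.T ω) ∂μ)
  simp only [mul_zero, add_zero, zero_add] at hlim
  refine hlim.congr fun l => ?_
  have hl := hexpansion (r.M ^ l) (hpow_pos l)
  simp only [Finset.Icc_self, Finset.sum_singleton] at hl
  rw [Function.comp_apply, ← hl, sub_add_cancel]

end Moments

/-! ### The centred level terms are martingale differences -/

section LevelTermMartingale

variable {Ω : Type*} {m mΩ : MeasurableSpace Ω} {μ : Measure Ω}
  {d q : ℕ} {r : Params} {Ψ : ℝ → E d → E q → E d} {x : E d} {P : E d → ℝ}

section SinglePath

variable {W : ℝ≥0 → Ω → E q} {θ : Ω → E q}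

lemma levelTerm_ae_eq_gridTerm (hT : 0 < r.T) (hM : 0 < r.M) (hm : 1 ≤ r.m)
    (hW : IsBrownianMotion W μ) (l : ℕ) (θ : Ω → E q) :
    (fun ω => levelTerm r Ψ x P l (fun t => W t ω) (θ ω)) =ᵐ[μ] fun ω =>
      gridTerm r Ψ x P l (θ ω) (gridIncr (r.steps l) (r.mesh l) fun t => W t ω) := by
  filter_upwards [hW.ae_zero] with ω hω
  exact levelTerm_eq_gridTerm hT hM hm l hω _

lemma indep_comap_gridIncr (hM : 0 < r.M) (hm : 1 ≤ r.m) (l : ℕ)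
    (hind : Indep m (pathSigma r.T W) μ) :
    Indep m (MeasurableSpace.comap
      (fun ω => gridIncr (r.steps l) (r.mesh l) fun t => W t ω) inferInstance) μ :=
  indep_of_indep_of_le_right hind <| Measurable.comap_le <|
    @measurable_gridIncr_mesh Ω (pathSigma r.T W) q r W hM hm
      (fun _ ht => measurable_pathSigma W ht) l

variable [IsProbabilityMeasure μ]

lemma condExp_levelTerm (hT : 0 < r.T) (hM : 0 < r.M) (hm : 1 ≤ r.m)
    (hΨ : ∀ h : ℝ, Measurable (Function.uncurry (Ψ h))) (hP : Measurable P)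
    (hW : IsBrownianMotion W μ) (hle : m ≤ mΩ) (hind : Indep m (pathSigma r.T W) μ)
    (hθ : Measurable[m] θ) (l : ℕ)
    (hint : Integrable (fun ω => levelTerm r Ψ x P l (fun t => W t ω) (θ ω)) μ) :
    μ[fun ω => levelTerm r Ψ x P l (fun t => W t ω) (θ ω) | m] =ᵐ[μ]
      fun _ => ∫ v, gridPayoff r Ψ x P l v ∂gridMeasure q (r.steps l) (r.mesh l) := by
  have hgrid := levelTerm_ae_eq_gridTerm (Ψ := Ψ) (x := x) (P := P) hT hM hm hW l θ
  refine (condExp_congr_ae hgrid).trans ((condExp_comp_prodMk_of_indep hle hθ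
    (measurable_gridIncr_mesh hM hm (fun t _ => hW.measurable t) l)
    (indep_comap_gridIncr hM hm l hind) (measurable_gridTerm hΨ hP l)
    (hint.congr hgrid)).trans (.of_forall fun ω => ?_))
  rw [hW.map_gridIncr]
  exact integral_gridShift_mul_girsanov (Params.mesh_pos hT hM hm l).ne'
    (Params.steps_mul_mesh hM hm l) _ (measurable_gridPayoff hΨ hP l)

lemma integral_levelTerm (hT : 0 < r.T) (hM : 0 < r.M) (hm : 1 ≤ r.m)
    (hΨ : ∀ h : ℝ, Measurable (Function.uncurry (Ψ h))) (hP : Measurable P)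
    (hW : IsBrownianMotion W μ) (hle : m ≤ mΩ) (hind : Indep m (pathSigma r.T W) μ)
    (hθ : Measurable[m] θ) (l : ℕ)
    (hint : Integrable (fun ω => levelTerm r Ψ x P l (fun t => W t ω) (θ ω)) μ) :
    ∫ ω, levelTerm r Ψ x P l (fun t => W t ω) (θ ω) ∂μ =
      ∫ v, gridPayoff r Ψ x P l v ∂gridMeasure q (r.steps l) (r.mesh l) := by
  rw [← integral_condExp hle,
    integral_congr_ae (condExp_levelTerm hT hM hm hΨ hP hW hle hind hθ l hint)]
  simp

lemma lintegral_enorm_levelTerm_rpow_le (hT : 0 < r.T) (hM : 0 < r.M) (hm : 1 ≤ r.m)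
    (hΨ : ∀ h : ℝ, Measurable (Function.uncurry (Ψ h))) (hP : Measurable P)
    (hW : IsBrownianMotion W μ) (hle : m ≤ mΩ) (hind : Indep m (pathSigma r.T W) μ)
    (hθ : Measurable[m] θ) {R : ℝ} (hR : ∀ ω, ‖θ ω‖ ≤ R) {s p a : ℝ} (hs : 1 ≤ s) (hsp : s < p)
    (ha : a = s * (p - 1) / (p - s)) (l : ℕ) :
    ∫⁻ ω, ‖levelTerm r Ψ x P l (fun t => W t ω) (θ ω)‖ₑ ^ s ∂μ ≤
      ∫⁻ v, ‖gridPayoff r Ψ x P l v‖ₑ ^ p ∂gridMeasure q (r.steps l) (r.mesh l) +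
        ENNReal.ofReal (Real.exp ((a ^ 2 - a) * R ^ 2 * r.T / 2)) := by
  have ha1 : 1 ≤ a := by
    rw [ha, one_le_div (by linarith)]
    nlinarith
  have hθΩ : Measurable θ := hθ.mono hle le_rfl
  have hgrid : ∫⁻ ω, ‖levelTerm r Ψ x P l (fun t => W t ω) (θ ω)‖ₑ ^ s ∂μ =
      ∫⁻ ω, ‖gridTerm r Ψ x P l (θ ω)
        (gridIncr (r.steps l) (r.mesh l) fun t => W t ω)‖ₑ ^ s ∂μ :=
    lintegral_congr_ae ((levelTerm_ae_eq_gridTerm hT hM hm hW l θ).fun_comp (‖·‖ₑ ^ s))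
  rw [hgrid, lintegral_comp_prodMk_of_indepFun hθΩ
      (measurable_gridIncr_mesh hM hm (fun t _ => hW.measurable t) l)
      (indep_of_indep_of_le_left (indep_comap_gridIncr hM hm l hind) hθ.comap_le)
      (F := fun z => ‖gridTerm r Ψ x P l z.1 z.2‖ₑ ^ s)
      ((measurable_gridTerm hΨ hP l).enorm.pow_const s), hW.map_gridIncr]
  calc _ ≤ ∫⁻ ω, (∫⁻ v, ‖gridPayoff r Ψ x P l v‖ₑ ^ p ∂gridMeasure q (r.steps l) (r.mesh l) +
        ENNReal.ofReal (Real.exp ((a ^ 2 - a) * ‖θ ω‖ ^ 2 * r.T / 2))) ∂μ :=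
        lintegral_mono fun ω => lintegral_enorm_gridShift_mul_girsanov_rpow_le
          (Params.mesh_pos hT hM hm l).ne' (Params.steps_mul_mesh hM hm l) _
          (measurable_gridPayoff hΨ hP l) (by linarith) hsp ha
    _ ≤ ∫⁻ _, (∫⁻ v, ‖gridPayoff r Ψ x P l v‖ₑ ^ p ∂gridMeasure q (r.steps l) (r.mesh l) +
        ENNReal.ofReal (Real.exp ((a ^ 2 - a) * R ^ 2 * r.T / 2))) ∂μ := by
        have haa : 0 ≤ a ^ 2 - a := by nlinarith
        gcongr
        exact hR _
    _ = _ := by rw [lintegral_const, measure_univ, mul_one]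

end SinglePath

variable [IsProbabilityMeasure μ] {W : ℕ → ℕ → ℝ≥0 → Ω → E q} {θ : ℕ → ℕ → Ω → E q}

lemma exists_eLpNorm_levelTerm_le (hT : 0 < r.T) (hM : 0 < r.M) (hm : 1 ≤ r.m)
    (hΨ : ∀ h : ℝ, Measurable (Function.uncurry (Ψ h))) (hP : Measurable P)
    (hW : ∀ l k, IsBrownianMotion (W l k) μ)
    (hWindep : iIndep (fun i : ℕ × ℕ => pathSigma r.T (W i.1 i.2)) μ)
    (hθ : ∀ l k, Measurable[pastSigma r.T W k] (θ l k)) {R : ℝ} (hR : ∀ l k ω, ‖θ l k ω‖ ≤ R)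
    {s p : ℝ} (hs : 1 ≤ s) (hsp : s < p) {C : ℝ≥0}
    (hC : ∀ l : ℕ, eLpNorm (gridPayoff r Ψ x P l) (ENNReal.ofReal p)
      (gridMeasure q (r.steps l) (r.mesh l)) ≤ C) :
    ∃ K : ℝ≥0, ∀ l k, eLpNorm (fun ω => levelTerm r Ψ x P l (fun t => W l k t ω) (θ l k ω))
      (ENNReal.ofReal s) μ ≤ K := by
  set a := s * (p - 1) / (p - s) with ha
  set K : ℝ≥0∞ :=
    ((C : ℝ≥0∞) ^ p + ENNReal.ofReal (Real.exp ((a ^ 2 - a) * R ^ 2 * r.T / 2))) ^ s⁻¹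
  have hK : K ≠ ∞ := ENNReal.rpow_ne_top_of_nonneg (by positivity) (ENNReal.add_ne_top.2
    ⟨ENNReal.rpow_ne_top_of_nonneg (by linarith) ENNReal.coe_ne_top, ENNReal.ofReal_ne_top⟩)
  refine ⟨K.toNNReal, fun l k => ?_⟩
  rw [ENNReal.coe_toNNReal hK]
  have hWm := fun l k => (hW l k).measurable
  refine eLpNorm_le_of_lintegral_enorm_rpow_le (by linarith)
    ((lintegral_enorm_levelTerm_rpow_le hT hM hm hΨ hP (hW l k) ((pastFiltration r.T W hWm).le k)
      (indep_pastSigma hWm hWindep l k) (hθ l k) (hR l k) hs hsp ha l).trans ?_)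
  gcongr
  exact lintegral_enorm_rpow_le_of_eLpNorm_le (by linarith) (hC l)

/-- The level terms of the estimator, centred by their common mean on each level. -/
def centredTerm (r : Params) (Ψ : ℝ → E d → E q → E d) (x : E d) (P : E d → ℝ)
    (W : ℕ → ℕ → ℝ≥0 → Ω → E q) (θ : ℕ → ℕ → Ω → E q) (l k : ℕ) (ω : Ω) : ℝ :=
  levelTerm r Ψ x P l (fun t => W l k t ω) (θ l k ω) -
    ∫ v, gridPayoff r Ψ x P l v ∂gridMeasure q (r.steps l) (r.mesh l)

lemma isMartingaleDifference_centredTerm (hT : 0 < r.T) (hM : 0 < r.M) (hm : 1 ≤ r.m)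
    (hΨ : ∀ h : ℝ, Measurable (Function.uncurry (Ψ h))) (hP : Measurable P)
    (hW : ∀ l k, IsBrownianMotion (W l k) μ)
    (hWindep : iIndep (fun i : ℕ × ℕ => pathSigma r.T (W i.1 i.2)) μ)
    (hθ : ∀ l k, Measurable[pastSigma r.T W k] (θ l k)) (l : ℕ)
    (hint : ∀ k, Integrable
      (fun ω => levelTerm r Ψ x P l (fun t => W l k t ω) (θ l k ω)) μ) :
    IsMartingaleDifference (pastFiltration r.T W fun l k => (hW l k).measurable)
      (centredTerm r Ψ x P W θ l) μ where
  stronglyMeasurable k := by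
    have hWk (t : ℝ≥0) (ht : t ≤ r.T) : Measurable[pastSigma r.T W (k + 1)] (W l k t) :=
      (measurable_pathSigma (W l k) ht).mono (pathSigma_le_pastSigma W l k.lt_succ_self) le_rfl
    have hterm := @measurable_levelTerm d q Ω (pastSigma r.T W (k + 1)) r Ψ x P hΨ hP _ _
      ((hθ l k).mono (pastSigma_mono W k.le_succ) le_rfl) l hWk
    exact (hterm.sub_const _).stronglyMeasurable
  integrable k := (hint k).sub (integrable_const _)
  condExp_eq_zero k := by
    have hWm := fun l k => (hW l k).measurable
    have hle := (pastFiltration r.T W hWm).le k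
    have hmean := condExp_levelTerm hT hM hm hΨ hP (hW l k) hle
      (indep_pastSigma hWm hWindep l k) (hθ l k) l (hint k)
    refine (condExp_sub (hint k) (integrable_const _) _).trans ?_
    rw [condExp_const hle]
    filter_upwards [hmean] with ω hω
    rw [Pi.sub_apply, hω, sub_self, Pi.zero_apply]

end LevelTermMartingale

/-! ### Convergence of the estimator -/

section Convergence

lemma div_mul_rpow_le {w x y N γ : ℝ} (hw : 0 ≤ w) (hwy : w ≤ y) (hx : 0 < x) (hγ0 : 0 ≤ γ)
    (hγ1 : γ ≤ 1) (hN : w * x ≤ N) : w / N * N ^ γ ≤ y ^ γ * x ^ (γ - 1) := by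
  rcases hw.eq_or_lt with rfl | hw
  · rw [zero_div, zero_mul]
    positivity
  have hwx : 0 < w * x := mul_pos hw hx
  have hN0 : 0 < N := hwx.trans_le hN
  calc w / N * N ^ γ = w * N ^ (γ - 1) := by
        rw [Real.rpow_sub_one hN0.ne', div_mul_eq_mul_div, mul_div_assoc]
    _ ≤ w * (w * x) ^ (γ - 1) := by
        gcongr w * ?_
        exact Real.rpow_le_rpow_of_nonpos hwx hN (by linarith)
    _ = w ^ γ * x ^ (γ - 1) := by
        rw [Real.mul_rpow hw.le hx.le, ← mul_assoc, Real.rpow_sub_one hw.ne',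
          mul_div_cancel₀ _ hw.ne']
    _ ≤ y ^ γ * x ^ (γ - 1) := by gcongr

lemma sum_two_pow_mul_exp_le (κ : ℝ) (L : ℕ) :
    ∑ l ∈ Finset.range L, 2 ^ l * Real.exp (κ * l) ≤ Real.exp ((2 + |κ|) * L) := by
  have hterm (l : ℕ) (hl : l ∈ Finset.range L) :
      2 ^ l * Real.exp (κ * l) ≤ Real.exp ((1 + |κ|) * L) := by
    have hlL : (l : ℝ) ≤ L := by exact_mod_cast (Finset.mem_range.1 hl).le
    calc 2 ^ l * Real.exp (κ * l) ≤ Real.exp 1 ^ l * Real.exp (|κ| * l) := by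
          gcongr
          · linarith [Real.add_one_le_exp 1]
          · exact le_abs_self κ
      _ = Real.exp ((1 + |κ|) * l) := by
          rw [← Real.exp_nat_mul, ← Real.exp_add]
          ring_nf
      _ ≤ Real.exp ((1 + |κ|) * L) := by gcongr
  calc ∑ l ∈ Finset.range L, 2 ^ l * Real.exp (κ * l) ≤ L * Real.exp ((1 + |κ|) * L) := by
        simpa using Finset.sum_le_card_nsmul _ _ _ hterm
    _ ≤ Real.exp L * Real.exp ((1 + |κ|) * L) := by
        gcongr
        linarith [Real.add_one_le_exp (L : ℝ)]
    _ = Real.exp ((2 + |κ|) * L) := by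
        rw [← Real.exp_add]
        ring_nf

lemma abs_div_mul_le {a n S x C K t γ : ℝ} (hK : 0 ≤ K) (ht : 0 ≤ t) (hx : 0 < x)
    (hγ0 : 0 ≤ γ) (hγ1 : γ ≤ 1) (ha : |a| ≤ C) (hn : |a| * x ≤ n) (hS : |S| ≤ K * t * n ^ γ) :
    |a / n * S| ≤ K * t * (C ^ γ * x ^ (γ - 1)) := by
  have hn0 : 0 ≤ n := (by positivity : 0 ≤ |a| * x).trans hn
  calc |a / n * S| = |a| / n * |S| := by rw [abs_mul, abs_div, abs_of_nonneg hn0]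
    _ ≤ |a| / n * (K * t * n ^ γ) := by gcongr
    _ = K * t * (|a| / n * n ^ γ) := by ring
    _ ≤ K * t * (C ^ γ * x ^ (γ - 1)) := by
        gcongr K * t * ?_
        exact div_mul_rpow_le (abs_nonneg _) ha hx hγ0 hγ1 hn

lemma mul_exp_div_sq_rpow {c ε : ℝ} (hc : 0 ≤ c) (hε : 0 ≤ ε) (y s : ℝ) :
    (c * Real.exp (-y) / ε ^ 2) ^ (-s) = c ^ (-s) * ε ^ (2 * s) * Real.exp (y * s) := by
  rw [Real.div_rpow (by positivity) (by positivity), Real.mul_rpow hc (Real.exp_pos _).le,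
    ← Real.exp_mul, ← Real.rpow_natCast_mul hε, div_eq_mul_inv, ← Real.rpow_neg hε]
  push_cast
  ring_nf

lemma tendsto_sum_cumWeight_div_levelN_mul {r : Params} (hT : 0 < r.T) (hM : 2 ≤ r.M)
    (hm : 1 ≤ r.m) (hα : 0 < r.α) (hV₁ : 0 < r.V₁) (hA : 0 < r.A) (hvar : 0 < r.varP)
    {γ K : ℝ} (hγ0 : 0 ≤ γ) (hγ1 : γ < 1) {S : ℕ → ℕ → ℝ}
    (hS : ∀ l n : ℕ, |S l n| ≤ K * 2 ^ l * (n : ℝ) ^ γ) :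
    Tendsto (fun ε => ∑ l ∈ Finset.range (r.numLevels ε),
      cumWeight r.α r.M (r.numLevels ε) l / (r.levelN ε l : ℝ) * S l (r.levelN ε l))
      (𝓝[>] 0) (𝓝 0) := by
  obtain ⟨c, κ, hc, hN⟩ := Params.exists_le_levelN hT hM hm hα hV₁ hvar
  obtain ⟨C, hC⟩ := exists_abs_cumWeight_le hα hM
  have hC0 : 0 ≤ C := (abs_nonneg _).trans (hC 0 0)
  have hK : 0 ≤ K := by simpa using (abs_nonneg _).trans (hS 0 1)
  have hterm {ε : ℝ} (hε : 0 < ε) (hL : 0 < r.numLevels ε) (l : ℕ) :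
      |cumWeight r.α r.M (r.numLevels ε) l / (r.levelN ε l : ℝ) * S l (r.levelN ε l)| ≤
        K * C ^ γ * c ^ (-(1 - γ)) * ε ^ (2 * (1 - γ)) *
          (2 ^ l * Real.exp (κ * (1 - γ) * l)) := by
    have hle := abs_div_mul_le (x := c * Real.exp (-(κ * l)) / ε ^ 2) hK
      (by positivity : (0 : ℝ) ≤ 2 ^ l) (by positivity) hγ0 hγ1.le (hC _ _)
      ((hN ε hL l).trans_eq' (by ring)) (hS l (r.levelN ε l))
    rw [← neg_sub 1 γ, mul_exp_div_sq_rpow hc.le hε.le] at hle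
    exact hle.trans_eq (by ring_nf)
  have hlim := (Params.tendsto_rpow_mul_exp_numLevels hM hα hA (δ := 2 * (1 - γ)) (by linarith)
    (2 + |κ * (1 - γ)|)).const_mul (K * C ^ γ * c ^ (-(1 - γ)))
  rw [mul_zero] at hlim
  refine squeeze_zero_norm' ?_ hlim
  filter_upwards [self_mem_nhdsWithin,
    (Params.tendsto_numLevels hM hα hA).eventually (eventually_gt_atTop 0)] with ε hε hL
  have hε0 : 0 < ε := hε
  calc _ ≤ ∑ l ∈ Finset.range (r.numLevels ε), K * C ^ γ * c ^ (-(1 - γ)) * ε ^ (2 * (1 - γ)) *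
          (2 ^ l * Real.exp (κ * (1 - γ) * l)) :=
        (Finset.abs_sum_le_sum_abs _ _).trans (Finset.sum_le_sum fun l _ => hterm hε hL l)
    _ ≤ _ := by
        rw [← Finset.mul_sum, ← mul_assoc]
        gcongr
        exact sum_two_pow_mul_exp_le _ _

variable {Ω : Type*} {d q : ℕ} {r : Params} {Ψ : ℝ → E d → E q → E d} {x : E d} {P : E d → ℝ}

lemma estimator_eq_sum_add_sum_centredTerm (hT : 0 < r.T) (hM : 2 ≤ r.M) (hm : 1 ≤ r.m)
    (hα : 0 < r.α) (hV₁ : 0 < r.V₁) (hvar : 0 < r.varP) (W : ℕ → ℕ → ℝ≥0 → Ω → E q)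
    (θ : ℕ → ℕ → Ω → E q) {ε : ℝ} (hε : 0 < ε) (hL : 0 < r.numLevels ε) (ω : Ω) :
    estimator r Ψ x P W θ ε ω =
      ∑ l ∈ Finset.range (r.numLevels ε), cumWeight r.α r.M (r.numLevels ε) l *
        ∫ v, gridPayoff r Ψ x P l v ∂gridMeasure q (r.steps l) (r.mesh l) +
      ∑ l ∈ Finset.range (r.numLevels ε),
        cumWeight r.α r.M (r.numLevels ε) l / (r.levelN ε l : ℝ) *
          ∑ k ∈ Finset.range (r.levelN ε l), centredTerm r Ψ x P W θ l k ω := by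
  have hestimator : estimator r Ψ x P W θ ε ω = ∑ l ∈ Finset.range (r.numLevels ε),
      cumWeight r.α r.M (r.numLevels ε) l / (r.levelN ε l : ℝ) *
        ∑ k ∈ Finset.range (r.levelN ε l),
          levelTerm r Ψ x P l (fun t => W l k t ω) (θ l k ω) := by
    rw [Finset.range_eq_Ico, Finset.sum_eq_sum_Ico_succ_bot hL, cumWeight_zero hα hM hL]
    rfl
  have hempty {l : ℕ} (hN : r.levelN ε l = 0) : cumWeight r.α r.M (r.numLevels ε) l = 0 := by
    obtain ⟨c, κ, hc, hle⟩ := Params.exists_le_levelN hT hM hm hα hV₁ hvar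
    by_contra hne
    have hpos := mul_pos (mul_pos hc (abs_pos.2 hne)) (Real.exp_pos (-(κ * l)))
    refine ((hle ε hL l).trans_lt' (div_pos hpos (by positivity))).ne' ?_
    rw [hN, Nat.cast_zero]
  rw [hestimator, ← Finset.sum_add_distrib]
  refine Finset.sum_congr rfl fun l _ => ?_
  simp only [centredTerm, Finset.sum_sub_distrib, Finset.sum_const, Finset.card_range,
    nsmul_eq_mul]
  rcases eq_or_ne (r.levelN ε l) 0 with hN | hN
  · simp [hempty hN]
  · field_simp
    ring

variable [mΩ : MeasurableSpace Ω] {μ : Measure Ω} [IsProbabilityMeasure μ]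
  {W : ℕ → ℕ → ℝ≥0 → Ω → E q} {θ : ℕ → ℕ → Ω → E q}

lemma exists_ae_abs_sum_centredTerm_le (hT : 0 < r.T) (hM : 0 < r.M) (hm : 1 ≤ r.m)
    (hΨ : ∀ h : ℝ, Measurable (Function.uncurry (Ψ h))) (hP : Measurable P)
    (hW : ∀ l k, IsBrownianMotion (W l k) μ)
    (hWindep : iIndep (fun i : ℕ × ℕ => pathSigma r.T (W i.1 i.2)) μ)
    (hθ : ∀ l k, Measurable[pastSigma r.T W k] (θ l k)) {R : ℝ} (hR : ∀ l k ω, ‖θ l k ω‖ ≤ R)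
    {p : ℝ} (hp : 1 < p) {C : ℝ≥0}
    (hC : ∀ l : ℕ, eLpNorm (gridPayoff r Ψ x P l) (ENNReal.ofReal p)
      (gridMeasure q (r.steps l) (r.mesh l)) ≤ C) :
    ∃ γ : ℝ, 0 ≤ γ ∧ γ < 1 ∧ ∀ᵐ ω ∂μ, ∃ K : ℝ, ∀ l n : ℕ,
      |∑ k ∈ Finset.range n, centredTerm r Ψ x P W θ l k ω| ≤ K * 2 ^ l * (n : ℝ) ^ γ := by
  obtain ⟨s, hs1, hs⟩ := exists_between (lt_min hp one_lt_two)
  obtain ⟨hsp, hs2⟩ := lt_min_iff.1 hs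
  obtain ⟨γ, hγs, hγ1⟩ := exists_between (inv_lt_one_of_one_lt₀ hs1)
  have hs0 : 0 < s := by linarith
  have hofReal : 1 ≤ ENNReal.ofReal s := by simpa using hs1.le
  obtain ⟨K, hK⟩ := exists_eLpNorm_levelTerm_le hT hM hm hΨ hP hW hWindep hθ hR hs1.le hsp hC
  have hWm := fun l k => (hW l k).measurable
  have hterm (l k : ℕ) : AEStronglyMeasurable
      (fun ω => levelTerm r Ψ x P l (fun t => W l k t ω) (θ l k ω)) μ :=
    (measurable_levelTerm hΨ hP ((hθ l k).mono ((pastFiltration r.T W hWm).le k) le_rfl) l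
      fun t _ => hWm l k t).aestronglyMeasurable
  have hLp (l k : ℕ) : MemLp (fun ω => levelTerm r Ψ x P l (fun t => W l k t ω) (θ l k ω))
      (ENNReal.ofReal s) μ := ⟨hterm l k, (hK l k).trans_lt ENNReal.coe_lt_top⟩
  have hint (l k : ℕ) := (hLp l k).integrable hofReal
  have hcentred (l k : ℕ) :
      eLpNorm (centredTerm r Ψ x P W θ l k) (ENNReal.ofReal s) μ ≤ (2 * K : ℝ≥0) := by
    have hmean := integral_levelTerm hT hM hm hΨ hP (hW l k) ((pastFiltration r.T W hWm).le k)
      (indep_pastSigma hWm hWindep l k) (hθ l k) l (hint l k)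
    unfold centredTerm
    rw [← hmean]
    refine (eLpNorm_sub_integral_le hofReal (hterm l k)).trans ?_
    push_cast
    gcongr
    exact hK l k
  refine ⟨γ, (inv_pos.2 hs0).le.trans hγs.le, hγ1, ae_exists_forall_abs_sum_le hs1.le hs2.le
    ((inv_pos.2 hs0).le.trans hγs.le) ((inv_lt_iff_one_lt_mul₀ hs0).1 hγs)
    (fun l => isMartingaleDifference_centredTerm hT hM hm hΨ hP hW hWindep hθ l (hint l))
    (fun l k => (hLp l k).sub (memLp_const _))
    fun l k => integral_abs_rpow_le_of_eLpNorm_le hs0 ((hLp l k).sub (memLp_const _)).1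
      (hcentred l k)⟩

end Convergence

lemma tendsto_nhdsGT_zero_of_summable_rpow {ε : ℕ → ℝ} (hε : ∀ k, 0 < ε k) {p : ℝ} (hp : 0 < p)
    (h : Summable fun k => ε k ^ p) : Tendsto ε atTop (𝓝[>] 0) := by
  refine tendsto_nhdsWithin_iff.2 ⟨?_, .of_forall hε⟩
  have hroot := h.tendsto_atTop_zero.rpow_const (p := p⁻¹) (Or.inr (by positivity))
  simpa only [Real.rpow_rpow_inv (hε _).le hp.ne', Real.zero_rpow (inv_ne_zero hp.ne')] using hroot

end AISML2R

end

open AISML2R in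
theorem theorem4_general {Ω : Type*} [MeasurableSpace Ω] (μ : Measure Ω) [IsProbabilityMeasure μ]
    {d q : ℕ} (r : Params) (hT : 0 < r.T) (hM : 2 ≤ r.M) (hm : 1 ≤ r.m) (hα : 0 < r.α)
    (hV₁ : 0 < r.V₁) (_hc : 0 < r.c) (hA : 0 < r.A) (hvar : 0 < r.varP)
    (x : E d) (P : E d → ℝ) (hP : Measurable P)
    (Ψ : ℝ → E d → E q → E d) (hΨ : ∀ h : ℝ, Measurable (Function.uncurry (Ψ h)))
    (W : ℕ → ℕ → ℝ≥0 → Ω → E q) (hW : ∀ l k, IsBrownianMotion (W l k) μ)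
    (hWindep : iIndep (fun i : ℕ × ℕ => pathSigma r.T (W i.1 i.2)) μ)
    (Θ : Set (E q)) (hΘ : Bornology.IsBounded Θ)
    (θ : ℕ → ℕ → Ω → E q) (hθmem : ∀ l k ω, θ l k ω ∈ Θ)
    (hθmeas : ∀ l k, Measurable[pastSigma r.T W k] (θ l k))
    (B : ℝ≥0 → Ω → E q) (hB : IsBrownianMotion B μ) (p : ℝ) (hp : 1 < p)
    (hLp : ∃ C : ℝ≥0, ∀ n : ℕ, 1 ≤ n →
      eLpNorm (approxPayoff r Ψ x P B n) (ENNReal.ofReal p) μ ≤ C)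
    (J : ℝ) (hJ : Tendsto (fun l => ∫ ω, approxPayoff r Ψ x P B (r.M ^ l) ω ∂μ) atTop (𝓝 J)) :
    ∀ᵐ ω ∂μ, Tendsto (fun ε => estimator r Ψ x P W θ ε ω) (𝓝[>] 0) (𝓝 J) := by
  have hM0 : 0 < r.M := by lia
  have hp1 : 1 ≤ ENNReal.ofReal p := by simpa using hp.le
  obtain ⟨C, hC⟩ := hLp
  obtain ⟨R, hR⟩ := hΘ.exists_norm_le
  have hCpow (l : ℕ) := hC (r.M ^ l) (Nat.pow_pos hM0)
  have hint (l : ℕ) : Integrable (approxPayoff r Ψ x P B (r.M ^ l)) μ :=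
    MemLp.integrable hp1 ⟨(measurable_approxPayoff hΨ hP hB.measurable _).aestronglyMeasurable,
      (hCpow l).trans_lt ENNReal.coe_lt_top⟩
  obtain ⟨γ, hγ0, hγ1, hfluctuation⟩ := exists_ae_abs_sum_centredTerm_le (C := C + C) hT hM0 hm
    hΨ hP hW hWindep hθmeas (fun l k ω => hR _ (hθmem l k ω)) hp
    (eLpNorm_gridPayoff_le hT hM0 hm hΨ hP hB hp1 hCpow)
  have hmean := (tendsto_sum_cumWeight_mul_levelDiff hα hM hJ).comp
    (Params.tendsto_numLevels hM hα hA)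
  filter_upwards [hfluctuation] with ω ⟨K, hK⟩
  have hlim := hmean.add
    (tendsto_sum_cumWeight_div_levelN_mul hT hM hm hα hV₁ hA hvar hγ0 hγ1 hK)
  rw [add_zero] at hlim
  refine hlim.congr' ?_
  filter_upwards [self_mem_nhdsWithin,
    (Params.tendsto_numLevels hM hα hA).eventually (eventually_gt_atTop 0)] with ε hε hL
  rw [estimator_eq_sum_add_sum_centredTerm hT hM hm hα hV₁ hvar W θ hε hL ω]
  simp only [Function.comp_apply, integral_gridPayoff hT hM0 hm hΨ hP hB hint]

open AISML2R in
theorem theorem4 {Ω : Type*} [mΩ : MeasurableSpace Ω] (μ : Measure Ω) [IsProbabilityMeasure μ]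
    {d q : ℕ} (r : Params)
    (hT : 0 < r.T) (hM : 2 ≤ r.M) (hm : 1 ≤ r.m) (hα : 0 < r.α) (hβ : 0 < r.β)
    (hV₁ : 0 < r.V₁) (hc : 0 < r.c) (hA : 0 < r.A)
    -- the stochastic differential equation and its solution
    (b : E d → E d) (σ : Fin q → E d → E d) (x : E d)
    (hLip : ∃ K : ℝ, 0 < K ∧ ∀ y z : E d,
      ‖b y - b z‖ + ∑ j, ‖σ j y - σ j z‖ ≤ K * ‖y - z‖)
    (𝓕 : Filtration ℝ≥0 mΩ) (B : ℝ≥0 → Ω → E q) (hB : IsFBrownianMotion 𝓕 B μ)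
    (X : ℝ≥0 → Ω → E d) (hX : IsSDESolution r.T b σ x 𝓕 B X μ)
    -- the payoff and the discretization scheme
    (P : E d → ℝ) (hP : Measurable P)
    (Ψ : ℝ → E d → E q → E d) (hΨ : ∀ h : ℝ, Measurable (Function.uncurry (Ψ h)))
    (hvar : r.varP = Var[fun ω => P (X r.T ω); μ]) (hvar_pos : 0 < r.varP)
    -- the independent sample paths, and the adaptive parameters
    (W : ℕ → ℕ → ℝ≥0 → Ω → E q) (hW : ∀ l k, IsBrownianMotion (W l k) μ)
    (hWindep : iIndep (fun i : ℕ × ℕ => pathSigma r.T (W i.1 i.2)) μ)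
    (Θ : Set (E q)) (hΘ : IsCompact Θ)
    (θ : ℕ → ℕ → Ω → E q) (hθmem : ∀ l k ω, θ l k ω ∈ Θ)
    (hθmeas : ∀ l k, Measurable[pastSigma r.T W k] (θ l k))
    (θstar : ℕ → E q) (hθstar : ∀ l, θstar l ∈ Θ)
    (hθlim : ∀ l, ∀ᵐ ω ∂μ, Tendsto (fun k => θ l k ω) atTop (𝓝 (θstar l)))
    -- the error assumptions
    (p : ℝ) (hp : 2 ≤ p)
    (hweak : WeakError r Ψ x P B X μ)
    (hLp : MemLp (fun ω => P (X r.T ω)) (ENNReal.ofReal p) μ)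
    (V : ℝ) (hV : 0 < V) (hstrong : StrongError r Ψ x P B X μ p V)
    -- the accuracies
    (ε : ℕ → ℝ) (hε : ∀ k, 0 < ε k) (hεsum : Summable fun k => ε k ^ p) :
    ∀ᵐ ω ∂μ, Tendsto (fun k => estimator r Ψ x P W θ (ε k) ω) atTop
      (𝓝 (∫ ω', P (X r.T ω') ∂μ)) := by
  exact (theorem4_general μ r hT hM hm hα hV₁ hc hA hvar_pos x P hP Ψ hΨ W hW hWindep Θ
    hΘ.isBounded θ hθmem hθmeas B hB.toIsBrownianMotion p (by linarith)
    (hstrong.exists_eLpNorm_approxPayoff_le hT hm hβ (by linarith) hΨ hP hB.measurable hV hLp) _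
    (hweak.tendsto hT hM hm hα)).mono fun ω hω =>
    hω.comp (tendsto_nhdsGT_zero_of_summable_rpow hε (by linarith) hεsum)
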